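/- Let $n\ge 0$. For each $t\in\mathbb{R}$ let $\alpha_0(t),\dots,\alpha_{n-1}(t)\in\mathbb{C}$ with $|\alpha_j(t)|<1$ and $\tau(t)\in\mathbb{C}$ with $|\tau(t)|=1$. Let $$G(t)=G_0G_1\cdots G_n,\qquad G_j=\operatorname{diag}\left(I_j,\begin{pmatrix}\overline{\alpha_j}&\rho_j\\ \rho_j&-\alpha_j\end{pmatrix},I_{n-j-1}\right)\ (0\le j\le n-1),\qquad G_n=\operatorname{diag}(I_n,\overline{\tau}),$$ where $\rho_j=(1-|\alpha_j|^2)^{1/2}$; this is an $(n+1)\times(n+1)$ unitary upper Hessenberg matrix. Assume that $G$ is a differentiable function of $t\in\mathbb{R}$. Fix $\zeta\in\mathbb{C}$ with $|\zeta|=1$ such that $\zeta$ is not an eigenvalue of $G(t)$ for any $t\in\mathbb{R}$, and fix one of the square roots $\zeta^{1/2}$. For each $t$ define $\tau_n(\zeta)=\tau$, $$\tau_j(\zeta)=\frac{\overline{\zeta}\,\alpha_j+\tau_{j+1}(\zeta)}{\overline{\alpha_j}\,\tau_{j+1}(\zeta)+\overline{\zeta}}\quad(j=n-1,\dots,0),$$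 and, with the convention $\alpha_{-1}=-1$, $$\beta_0(\zeta)=\frac{1}{\zeta^{-1/2}-\tau_0(\zeta)\,\zeta^{1/2}},\qquad \beta_{j+1}(\zeta)=\frac{1}{\beta_j(\zeta)}\,\frac{1}{\overline{\zeta}+\tau_j(\zeta)\,\overline{\alpha_{j-1}}}\,\frac{1}{1-\overline{\tau_j(\zeta)}\,\alpha_j}\quad(j=0,\dots,n-1).$$ Let $A$ be $\zeta^{1/2}$ times the $(n+1)\times(n+1)$ lower bidiagonal matrix with diagonal entries $\overline{\beta_0(\zeta)},\dots,\overline{\beta_n(\zeta)}$ and all subdiagonal entries equal to $-1$, and let $H=(A+A^*)/2$. Put $$y_j(t)=\frac{\mathrm{d}}{\mathrm{d}t}\,\operatorname{Im}\left(\zeta^{-1/2}\beta_j(\zeta)\right),\qquad I_{0+}=\{t\in\mathbb{R}: y_j(t)>0\ \text{for all } 0\le j\le n\},\qquad I_{0-}=\{t\in\mathbb{R}: y_j(t)<0\ \text{for all } 0\le j\le n\}.$$ Assume that $H$ does not depend on $t$. Then the eigenvalues of $G$ move strictly counterclockwise (respectively, clockwise) along the unit circle as $t$ increases on each of the nondegenerate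 intervals (those with more than one point) that make up the set $I_{0+}$ (respectively, $I_{0-}$). That is, there are continuous functions $\theta_0,\dots,\theta_n:\mathbb{R}\to\mathbb{R}$ such that for every $t\in\mathbb{R}$ the numbers $e^{i\theta_0(t)},\dots,e^{i\theta_n(t)}$ are pairwise distinct and are exactly the eigenvalues of $G(t)$, and every $\theta_j$ is strictly increasing on each nondegenerate interval contained in $I_{0+}$ and strictly decreasing on each nondegenerate interval contained in $I_{0-}$. -/

import Mathlib

noncomputable section

namespace Popuc

open Matrix ComplexConjugate

/-- The `(n+1) × (n+1)` matrix `diag (I_j, Θ(a), I_{n-j-1})`, where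
`Θ(a) = !![conj a, ρ; ρ, -a]` with `ρ = (1 - |a|²)^{1/2}`. -/
def thetaBlock {n : ℕ} (j : Fin n) (a : ℂ) : Matrix (Fin (n + 1)) (Fin (n + 1)) ℂ :=
  Matrix.of fun i k =>
    if i = j.castSucc ∧ k = j.castSucc then conj a
    else if i = j.castSucc ∧ k = j.succ then ((Real.sqrt (1 - ‖a‖ ^ 2) : ℝ) : ℂ)
    else if i = j.succ ∧ k = j.castSucc then ((Real.sqrt (1 - ‖a‖ ^ 2) : ℝ) : ℂ)
    else if i = j.succ ∧ k = j.succ then -a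
    else if i = k then 1
    else 0

/-- The unitary upper Hessenberg matrix `G(α₀, …, α_{n-1}, τ) = G₀ G₁ ⋯ G_n`, where
`G_j = diag (I_j, Θ(α_j), I_{n-j-1})` for `j < n` and `G_n = diag (I_n, conj τ)`. -/
def hessenberg {n : ℕ} (α : Fin n → ℂ) (τ : ℂ) : Matrix (Fin (n + 1)) (Fin (n + 1)) ℂ :=
  (List.ofFn fun j : Fin n => thetaBlock j (α j)).prod *
    Matrix.diagonal fun i => if i = Fin.last n then conj τ else 1

/-- The pseudo-reflection coefficients: `τ_n(ζ) = τ` and, going down,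
`τ_j(ζ) = (conj ζ * α_j + τ_{j+1}(ζ)) / (conj α_j * τ_{j+1}(ζ) + conj ζ)`. -/
def pseudoReflection {n : ℕ} (α : Fin n → ℂ) (τ ζ : ℂ) : Fin (n + 1) → ℂ :=
  Fin.reverseInduction (motive := fun _ => ℂ) τ fun j T =>
    (conj ζ * α j + T) / (conj (α j) * T + conj ζ)

/-- The coefficients with a shifted index and the convention `α_{-1} = -1`: the value at `j` is
`α_{j-1}`. -/
def shifted {n : ℕ} (α : Fin n → ℂ) : Fin (n + 1) → ℂ :=
  Fin.cons (-1) α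

/-- The numbers `β_j(ζ)`, for the square root `s` of `ζ`:
`β_0 = 1 / (s⁻¹ - τ_0(ζ) s)` and, for `j = 0, …, n - 1`,
`β_{j+1} = 1 / β_j * (1 / (conj ζ + τ_j(ζ) conj α_{j-1})) * (1 / (1 - conj τ_j(ζ) α_j))`. -/
def beta {n : ℕ} (α : Fin n → ℂ) (τ ζ s : ℂ) : Fin (n + 1) → ℂ :=
  Fin.induction (motive := fun _ => ℂ)
    (1 / (s⁻¹ - pseudoReflection α τ ζ 0 * s))
    fun j b =>
      1 / b *
        (1 / (conj ζ + pseudoReflection α τ ζ j.castSucc * conj (shifted α j.castSucc))) *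
        (1 / (1 - conj (pseudoReflection α τ ζ j.castSucc) * α j))

/-- The lower bidiagonal matrix `A`: `s` times the matrix with diagonal entries `conj β_j` and
subdiagonal entries `-1`. -/
def dissipative {n : ℕ} (α : Fin n → ℂ) (τ ζ s : ℂ) : Matrix (Fin (n + 1)) (Fin (n + 1)) ℂ :=
  s • Matrix.of fun i k =>
    if i = k then conj (beta α τ ζ s i)
    else if (i : ℕ) = (k : ℕ) + 1 then -1
    else 0

/-- The Hermitian part `H = (A + A*) / 2` of the Toeplitz decomposition `A = H + i K`. -/
def hermitianPart {n : ℕ} (α : Fin n → ℂ) (τ ζ s : ℂ) : Matrix (Fin (n + 1)) (Fin (n + 1)) ℂ :=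
  (1 / 2 : ℂ) • (dissipative α τ ζ s + (dissipative α τ ζ s)ᴴ)

/-- The derivative `y_j` at `t` of the imaginary part of `ζ^{-1/2} β_j(ζ)`, for a curve
`(α, τ)` of parameters. -/
def imDeriv {n : ℕ} (α : ℝ → Fin n → ℂ) (τ : ℝ → ℂ) (ζ s : ℂ) (j : Fin (n + 1)) (t : ℝ) : ℝ :=
  deriv (fun u : ℝ => (s⁻¹ * beta (α u) (τ u) ζ s j).im) t

end Popuc

end

/-! Write A = H + iK with H and K Hermitian. If Kx = cHx with x ≠ 0, then (A* + wA)x = 0 for w = (c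
+ i)/(c - i), and an upper bidiagonal change of variables turns x into a left eigenvector of G with
eigenvalue ζw (`mem_spectrum_of_pencil_mulVec_eq_zero`).

Since ζ is not an eigenvalue, ζτ_0 ≠ 1; then 2H has an explicit bidiagonal factorization with
positive pivots, so H is positive definite (`posDef_hermitianPart`). With H = C*C, the numbers c are
the eigenvalues of the Hermitian matrix obtained from K by congruence with C⁻¹. The pencil A* + wA
is tridiagonal with nonzero superdiagonal, so its kernel is at most a line: the n + 1 values c are
distinct (`eigenvalues_reduced_injective`) and account for the whole spectrum of G.

The off-diagonal part of K is constant and its diagonal entries are -Im(ζ^{-1/2} β_j). As H, hence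
C, is constant, on an interval in I_{0+} the diagonal of K strictly decreases, Weyl's inequality
pushes every ordered c strictly down (`eigenvalues_reduced_lt`), and the angle arg ζ + π - 2 arctan
c goes strictly up; I_{0-} is symmetric. No eigenvalue is ever differentiated, and the same
inequality makes the angles continuous. -/

/-! ### Weyl's inequality and continuity of ordered eigenvalues -/

section HermitianEigenvalues

open Matrix

variable {ι : Type*} [Fintype ι]

theorem Matrix.IsHermitian.re_dotProduct_mulVec_eq_sum [DecidableEq ι] {A : Matrix ι ι ℂ} (hA : A.IsHermitian)
    (x : EuclideanSpace ℂ ι) :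
    (star x.ofLp ⬝ᵥ A *ᵥ x.ofLp).re =
      ∑ j, hA.eigenvalues j * ‖inner ℂ (hA.eigenvectorBasis j) x‖ ^ 2 := by
  have hsym := isSymmetric_toEuclideanLin_iff.mpr hA
  have h1 : star x.ofLp ⬝ᵥ A *ᵥ x.ofLp = inner ℂ x (toEuclideanLin A x) := by
    rw [EuclideanSpace.inner_eq_star_dotProduct, dotProduct_comm]
    rfl
  rw [h1, ← hA.eigenvectorBasis.sum_inner_mul_inner, Complex.re_sum]
  refine Finset.sum_congr rfl fun j _ => ?_
  have h2 : toEuclideanLin A (hA.eigenvectorBasis j) =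
      ((hA.eigenvalues j : ℝ) : ℂ) • hA.eigenvectorBasis j := by
    ext i
    have := congrFun (hA.mulVec_eigenvectorBasis j) i
    simpa using this
  rw [← hsym, h2, inner_smul_left, ← inner_conj_symm x]
  have h3 := Complex.mul_conj (inner ℂ (hA.eigenvectorBasis j) x)
  rw [Complex.normSq_eq_norm_sq] at h3
  rw [Complex.conj_ofReal, mul_left_comm, mul_comm ((starRingEnd ℂ) _), h3, ← Complex.ofReal_mul,
    Complex.ofReal_re]

/-- A form of Weyl's inequality for eigenvalues. -/
theorem Matrix.IsHermitian.eigenvalues_lt_eigenvalues_add [DecidableEq ι] {A B : Matrix ι ι ℂ}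
    (hA : A.IsHermitian) (hB : B.IsHermitian) {ε : ℝ}
    (h : ∀ x : ι → ℂ, x ≠ 0 →
      (star x ⬝ᵥ A *ᵥ x).re < (star x ⬝ᵥ B *ᵥ x).re + ε * ∑ i, ‖x i‖ ^ 2) (i : ι) :
    hA.eigenvalues i < hB.eigenvalues i + ε := by
  -- The enumeration inside the definition of `eigenvalues`; along it the eigenvalues are
  -- nonincreasing.
  set e : ι ≃ Fin (Fintype.card ι) := (Fintype.equivOfCardEq (Fintype.card_fin _)).symm with he
  have hAe : ∀ j, hA.eigenvalues j = hA.eigenvalues₀ (e j) := fun j => rfl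
  have hBe : ∀ j, hB.eigenvalues j = hB.eigenvalues₀ (e j) := fun j => rfl
  -- The test vector is to be orthogonal to the eigenvectors of `B` placed before `i` and to those
  -- of `A` placed after `i`: one condition fewer than the dimension, so a nonzero vector survives.
  let L : EuclideanSpace ℂ ι →ₗ[ℂ] ({j : ι // j ≠ i} → ℂ) :=
    LinearMap.pi fun j => if e j.1 < e i then (innerₛₗ ℂ (hB.eigenvectorBasis j.1))
      else (innerₛₗ ℂ (hA.eigenvectorBasis j.1))
  have hker : LinearMap.ker L ≠ ⊥ := by
    apply LinearMap.ker_ne_bot_of_finrank_lt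
    rw [finrank_euclideanSpace, Module.finrank_fintype_fun_eq_card]
    exact Fintype.card_subtype_lt (x := i) (by simp)
  obtain ⟨x, hx, hx0⟩ := Submodule.exists_mem_ne_zero_of_ne_bot hker
  have hL : ∀ j, j ≠ i → (e j < e i → inner ℂ (hB.eigenvectorBasis j) x = 0) ∧
      (¬ e j < e i → inner ℂ (hA.eigenvectorBasis j) x = 0) := by
    intro j hj
    have := congrFun (LinearMap.mem_ker.mp hx) ⟨j, hj⟩
    constructor
    · intro hlt
      simpa [L, hlt] using this
    · intro hlt
      simpa [L, hlt] using this
  have hx' : x.ofLp ≠ 0 := by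
    intro h0
    exact hx0 (by ext k; simp [h0])
  have hq := h x.ofLp hx'
  rw [hA.re_dotProduct_mulVec_eq_sum, hB.re_dotProduct_mulVec_eq_sum,
    ← EuclideanSpace.norm_sq_eq] at hq
  have h1 : hA.eigenvalues i * ‖x‖ ^ 2 ≤
      ∑ j, hA.eigenvalues j * ‖inner ℂ (hA.eigenvectorBasis j) x‖ ^ 2 := by
    rw [← hA.eigenvectorBasis.sum_sq_norm_inner_right x, Finset.mul_sum]
    refine Finset.sum_le_sum fun j _ => ?_
    by_cases hji : j = i
    · rw [hji]
    by_cases hlt : e j < e i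
    · exact mul_le_mul_of_nonneg_right (hA.eigenvalues₀_antitone hlt.le) (by positivity)
    · rw [(hL j hji).2 hlt]
      simp
  have h2 : ∑ j, hB.eigenvalues j * ‖inner ℂ (hB.eigenvectorBasis j) x‖ ^ 2 ≤
      hB.eigenvalues i * ‖x‖ ^ 2 := by
    rw [← hB.eigenvectorBasis.sum_sq_norm_inner_right x, Finset.mul_sum]
    refine Finset.sum_le_sum fun j _ => ?_
    by_cases hlt : e j < e i
    · rw [(hL j (by rintro rfl; exact lt_irrefl _ hlt)).1 hlt]
      simp
    · exact mul_le_mul_of_nonneg_right (hB.eigenvalues₀_antitone (not_lt.mp hlt)) (by positivity)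
  have hpos : 0 < ‖x‖ ^ 2 := by
    have := norm_pos_iff.mpr hx0
    positivity
  nlinarith

theorem Matrix.abs_re_dotProduct_mulVec_le (D : Matrix ι ι ℂ) (x : ι → ℂ) :
    |(star x ⬝ᵥ D *ᵥ x).re| ≤ (∑ i, ∑ j, ‖D i j‖) * ∑ i, ‖x i‖ ^ 2 := by
  refine (Complex.abs_re_le_norm _).trans ?_
  have hx : ∀ i j, ‖x i‖ * ‖x j‖ ≤ ∑ k, ‖x k‖ ^ 2 := by
    intro i j
    have hi := Finset.single_le_sum (f := fun k => ‖x k‖ ^ 2) (fun k _ => by positivity)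
      (Finset.mem_univ i)
    have hj := Finset.single_le_sum (f := fun k => ‖x k‖ ^ 2) (fun k _ => by positivity)
      (Finset.mem_univ j)
    nlinarith [sq_nonneg (‖x i‖ - ‖x j‖)]
  simp only [dotProduct, mulVec, Finset.mul_sum, Finset.sum_mul (ι := ι)]
  refine (norm_sum_le _ _).trans (Finset.sum_le_sum fun i _ => ?_)
  refine (norm_sum_le _ _).trans (Finset.sum_le_sum fun j _ => ?_)
  rw [← Finset.mul_sum, norm_mul, norm_mul, Pi.star_apply, norm_star, mul_left_comm]
  exact mul_le_mul_of_nonneg_left (hx i j) (norm_nonneg _)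

/-- Weyl's inequality used both ways: entrywise closeness makes the two quadratic forms differ by
less than ε times the squared norm. -/
theorem Matrix.continuous_eigenvalues [DecidableEq ι] {X : Type*} [TopologicalSpace X] {A : X → Matrix ι ι ℂ}
    (hA : ∀ t, (A t).IsHermitian) (hc : ∀ i j, Continuous fun t => A t i j) (i : ι) :
    Continuous fun t => (hA t).eigenvalues i := by
  rw [continuous_iff_continuousAt]
  intro t₀
  rw [ContinuousAt, Metric.tendsto_nhds]
  intro ε hε
  have hS : Continuous fun t => ∑ j, ∑ k, ‖A t j k - A t₀ j k‖ := by fun_prop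
  have hev : ∀ᶠ t in nhds t₀, ∑ j, ∑ k, ‖A t j k - A t₀ j k‖ < ε :=
    hS.continuousAt.eventually_lt_const (by simpa using hε)
  filter_upwards [hev] with t ht
  have key : ∀ x : ι → ℂ, x ≠ 0 →
      |(star x ⬝ᵥ A t *ᵥ x).re - (star x ⬝ᵥ A t₀ *ᵥ x).re| < ε * ∑ i, ‖x i‖ ^ 2 := by
    intro x hx
    have hpos : 0 < ∑ i, ‖x i‖ ^ 2 := by
      obtain ⟨k, hk⟩ := Function.ne_iff.mp hx
      have : 0 < ‖x k‖ ^ 2 := by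
        have := norm_pos_iff.mpr hk
        positivity
      exact Finset.sum_pos' (fun _ _ => by positivity) ⟨k, Finset.mem_univ _, this⟩
    have := abs_re_dotProduct_mulVec_le (A t - A t₀) x
    rw [sub_mulVec, dotProduct_sub, Complex.sub_re] at this
    exact this.trans_lt (mul_lt_mul_of_pos_right (by simpa using ht) hpos)
  rw [Real.dist_eq, abs_lt]
  have h1 := (hA t).eigenvalues_lt_eigenvalues_add (hA t₀) (ε := ε)
    (fun x hx => by have := (abs_lt.mp (key x hx)).2; linarith) i
  have h2 := (hA t₀).eigenvalues_lt_eigenvalues_add (hA t) (ε := ε)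
    (fun x hx => by have := (abs_lt.mp (key x hx)).1; linarith) i
  constructor <;> linarith

end HermitianEigenvalues

/-! ### Row recursion for the Hessenberg matrix and continuity of its parameters -/

namespace Popuc

open Matrix ComplexConjugate

theorem vecMul_prod_ofFn {m R : Type*} [Fintype m] [DecidableEq m] [Semiring R] {n : ℕ}
    (T : Fin n → Matrix m m R) (v : Fin (n + 1) → m → R)
    (h : ∀ j : Fin n, v j.castSucc ᵥ* T j = v j.succ) :
    v 0 ᵥ* (List.ofFn T).prod = v (Fin.last n) := by
  induction n with
  | zero => simp
  | succ n ih =>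
    rw [List.ofFn_succ, List.prod_cons, ← vecMul_vecMul]
    have h0 := h 0
    rw [Fin.castSucc_zero] at h0
    rw [h0]
    exact ih (fun j => T j.succ) (fun j => v j.succ) fun j => h j.succ

theorem vecMul_thetaBlock {n : ℕ} (j : Fin n) (a : ℂ) (v : Fin (n + 1) → ℂ) (k : Fin (n + 1)) :
    (v ᵥ* thetaBlock j a) k =
      if k = j.castSucc then v j.castSucc * conj a + v j.succ * (Real.sqrt (1 - ‖a‖ ^ 2) : ℝ)
      else if k = j.succ then v j.castSucc * (Real.sqrt (1 - ‖a‖ ^ 2) : ℝ) - v j.succ * a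
      else v k := by
  have hne : j.castSucc ≠ j.succ := Fin.castSucc_lt_succ.ne
  simp only [vecMul, dotProduct, thetaBlock, Matrix.of_apply]
  split_ifs with h1 h2
  · subst h1
    rw [Finset.sum_eq_add j.castSucc j.succ hne]
    · simp [hne, hne.symm]
    · rintro c - ⟨hc1, hc2⟩
      simp [hc1, hc2]
    all_goals simp
  · subst h2
    rw [Finset.sum_eq_add j.castSucc j.succ hne]
    · simp [hne.symm, sub_eq_add_neg]
    · rintro c - ⟨hc1, hc2⟩
      simp [hc1, hc2]
    all_goals simp
  · simp [h1, h2]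

/-- A row vector `y` is multiplied by the Hessenberg matrix along a Szegő-type recursion. -/
theorem vecMul_hessenberg {n : ℕ} {α : Fin n → ℂ} {τ : ℂ} {y u r : Fin (n + 1) → ℂ}
    (h0 : u 0 = y 0)
    (hr : ∀ j : Fin n, r j.castSucc =
      conj (α j) * u j.castSucc + (Real.sqrt (1 - ‖α j‖ ^ 2) : ℝ) * y j.succ)
    (hu : ∀ j : Fin n, u j.succ =
      (Real.sqrt (1 - ‖α j‖ ^ 2) : ℝ) * u j.castSucc - α j * y j.succ)
    (hn : r (Fin.last n) = conj τ * u (Fin.last n)) :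
    y ᵥ* hessenberg α τ = r := by
  -- The row after the factors G_0, …, G_{j-1}: entries before j are final, entry j is the carry `u
  -- j`, later entries are untouched.
  let v : Fin (n + 1) → Fin (n + 1) → ℂ := fun j k => if k < j then r k else
    if k = j then u j else y k
  have hv0 : v 0 = y := by
    funext k
    by_cases hk : k = 0
    · simp [v, hk, h0]
    · simp [v, hk]
  have hstep : ∀ j : Fin n, v j.castSucc ᵥ* thetaBlock j (α j) = v j.succ := by
    intro j
    have e1 : v j.castSucc j.castSucc = u j.castSucc := by simp [v]
    have e2 : v j.castSucc j.succ = y j.succ := by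
      have h1 : ¬ j.succ < j.castSucc := by simp [Fin.lt_def]
      have h2 : j.succ ≠ j.castSucc := Fin.castSucc_lt_succ.ne'
      simp only [v, if_neg h1, if_neg h2]
    funext k
    rw [vecMul_thetaBlock, e1, e2]
    by_cases h1 : k = j.castSucc
    · subst h1
      simp [v, hr, mul_comm]
    by_cases h2 : k = j.succ
    · subst h2
      simp [v, h1, hu, mul_comm]
    rw [if_neg h1, if_neg h2]
    have h3 : (k < j.castSucc) ↔ (k < j.succ) := by
      have h1' : (k : ℕ) ≠ j := fun h => h1 (Fin.ext h)
      simp only [Fin.lt_def, Fin.val_castSucc, Fin.val_succ]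
      omega
    simp only [v, h1, h2, h3, if_false]
  rw [hessenberg, ← vecMul_vecMul, ← hv0, vecMul_prod_ofFn _ v hstep]
  funext k
  rw [vecMul_diagonal]
  by_cases hk : k = Fin.last n
  · subst hk
    simp [v, hn, mul_comm]
  · have : k < Fin.last n := Fin.lt_last_iff_ne_last.mpr hk
    simp [v, hk, this]

theorem mem_spectrum_of_vecMul_eq_smul {m : Type*} [Fintype m] [DecidableEq m]
    {M : Matrix m m ℂ} {y : m → ℂ} {z : ℂ} (hy : y ≠ 0) (h : y ᵥ* M = z • y) :
    z ∈ spectrum ℂ M := by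
  rw [spectrum.mem_iff, Matrix.isUnit_iff_isUnit_det, isUnit_iff_ne_zero, not_not,
    ← Matrix.exists_vecMul_eq_zero_iff]
  refine ⟨y, hy, ?_⟩
  rw [vecMul_sub, h, Algebra.algebraMap_eq_smul_one, vecMul_smul, vecMul_one, sub_self]

theorem sqrt_one_sub_sq_pos {a : ℂ} (ha : ‖a‖ < 1) : 0 < Real.sqrt (1 - ‖a‖ ^ 2) := by
  apply Real.sqrt_pos.mpr
  nlinarith [norm_nonneg a]

theorem ofReal_sqrt_mul_self {a : ℂ} (ha : ‖a‖ < 1) :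
    ((Real.sqrt (1 - ‖a‖ ^ 2) : ℝ) : ℂ) * (Real.sqrt (1 - ‖a‖ ^ 2) : ℝ) = 1 - a * conj a := by
  rw [← Complex.ofReal_mul, Real.mul_self_sqrt (by nlinarith [norm_nonneg a]), Complex.mul_conj,
    Complex.normSq_eq_norm_sq]
  push_cast
  ring

/-- The products `ρ_0 ⋯ ρ_{j-1}`. -/
noncomputable def rhoProd {n : ℕ} (α : Fin n → ℂ) : Fin (n + 1) → ℝ :=
  Fin.induction (motive := fun _ => ℝ) 1 fun j p => Real.sqrt (1 - ‖α j‖ ^ 2) * p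

theorem rhoProd_succ {n : ℕ} (α : Fin n → ℂ) (j : Fin n) :
    rhoProd α j.succ = Real.sqrt (1 - ‖α j‖ ^ 2) * rhoProd α j.castSucc := rfl

theorem rhoProd_pos {n : ℕ} {α : Fin n → ℂ} (hα : ∀ j, ‖α j‖ < 1) (j : Fin (n + 1)) :
    0 < rhoProd α j := by
  induction j using Fin.induction with
  | zero => exact one_pos
  | succ j ih =>
    rw [rhoProd_succ]
    exact mul_pos (sqrt_one_sub_sq_pos (hα j)) ih

/-- The first row of the Hessenberg matrix. -/
theorem hessenberg_zero_apply {n : ℕ} (α : Fin n → ℂ) (τ : ℂ) (k : Fin (n + 1)) :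
    hessenberg α τ 0 k =
      (Fin.snoc (α := fun _ => ℂ) (fun j => conj (α j)) (conj τ) : Fin (n + 1) → ℂ) k *
        rhoProd α k := by
  have h := vecMul_hessenberg (α := α) (τ := τ) (y := Pi.single 0 1)
    (u := fun k => (rhoProd α k : ℂ))
    (r := fun k => (Fin.snoc (α := fun _ => ℂ) (fun j => conj (α j)) (conj τ) :
      Fin (n + 1) → ℂ) k * rhoProd α k) (by simp [rhoProd]) (fun j => by simp)
      (fun j => by simp [rhoProd_succ]) (by simp)
  have := congrFun h k
  rwa [single_one_vecMul] at this

section Continuity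

variable {X : Type*} [TopologicalSpace X] {n : ℕ} {α : X → Fin n → ℂ} {τ : X → ℂ}

theorem continuous_of_mul_rhoProd (hα : ∀ t j, ‖α t j‖ < 1) {k : Fin (n + 1)} {f : X → ℂ}
    (hρ : Continuous fun t => rhoProd (α t) k)
    (h : Continuous fun t => conj (f t) * (rhoProd (α t) k : ℂ)) : Continuous f := by
  have hne : ∀ t, (rhoProd (α t) k : ℂ) ≠ 0 := fun t =>
    Complex.ofReal_ne_zero.mpr (rhoProd_pos (hα t) k).ne'
  have h2 : Continuous fun t => conj ((conj (f t) * (rhoProd (α t) k : ℂ)) /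
      (rhoProd (α t) k : ℂ)) :=
    Complex.continuous_conj.comp (h.div (Complex.continuous_ofReal.comp hρ) hne)
  refine h2.congr fun t => ?_
  rw [mul_div_cancel_right₀ _ (hne t), Complex.conj_conj]

/-- The first row of G contains conj α_k times ρ_0 ⋯ ρ_{k-1}. Once this product is continuous,
division recovers α_k, hence ρ_k and the next product. -/
theorem continuous_rhoProd (hα : ∀ t j, ‖α t j‖ < 1)
    (hG : ∀ k, Continuous fun t => hessenberg (α t) (τ t) 0 k) (k : Fin (n + 1)) :
    Continuous fun t => rhoProd (α t) k := by
  induction k using Fin.induction with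
  | zero => exact continuous_const
  | succ j ih =>
    have hj : Continuous fun t => α t j := by
      refine continuous_of_mul_rhoProd hα ih ?_
      simpa [hessenberg_zero_apply] using hG j.castSucc
    simp only [rhoProd_succ]
    fun_prop

theorem continuous_parameter (hα : ∀ t j, ‖α t j‖ < 1)
    (hG : ∀ k, Continuous fun t => hessenberg (α t) (τ t) 0 k) (j : Fin n) :
    Continuous fun t => α t j :=
  continuous_of_mul_rhoProd hα (continuous_rhoProd hα hG j.castSucc)
    (by simpa [hessenberg_zero_apply] using hG j.castSucc)

theorem continuous_last_parameter (hα : ∀ t j, ‖α t j‖ < 1)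
    (hG : ∀ k, Continuous fun t => hessenberg (α t) (τ t) 0 k) : Continuous τ :=
  continuous_of_mul_rhoProd hα (continuous_rhoProd hα hG (Fin.last n))
    (by simpa [hessenberg_zero_apply] using hG (Fin.last n))

end Continuity

end Popuc

/-! ### Pseudo-reflection coefficients -/

namespace Popuc

open Matrix ComplexConjugate

section PseudoReflection

variable {n : ℕ} {α : Fin n → ℂ} {τ ζ s : ℂ}

theorem pseudoReflection_last (α : Fin n → ℂ) (τ ζ : ℂ) :
    pseudoReflection α τ ζ (Fin.last n) = τ := by
  simp [pseudoReflection]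

theorem pseudoReflection_castSucc (α : Fin n → ℂ) (τ ζ : ℂ) (j : Fin n) :
    pseudoReflection α τ ζ j.castSucc =
      (conj ζ * α j + pseudoReflection α τ ζ j.succ) /
        (conj (α j) * pseudoReflection α τ ζ j.succ + conj ζ) := by
  simp [pseudoReflection]

theorem mul_conj_of_norm_eq_one {z : ℂ} (hz : ‖z‖ = 1) : z * conj z = 1 := by
  rw [Complex.mul_conj, Complex.normSq_eq_norm_sq, hz]
  simp

theorem one_sub_ne_zero_of_norm_lt_one {z : ℂ} (hz : ‖z‖ < 1) : 1 - z ≠ 0 := by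
  intro h
  rw [← sub_eq_zero.mp h] at hz
  simp at hz

theorem conj_mul_add_conj_ne_zero {a T : ℂ} (ha : ‖a‖ < 1) (hT : ‖T‖ = 1) (hζ : ‖ζ‖ = 1) :
    conj a * T + conj ζ ≠ 0 := by
  intro h
  have h1 : conj a * T = -conj ζ := eq_neg_of_add_eq_zero_left h
  have h2 := congrArg norm h1
  rw [norm_mul, norm_neg, RCLike.norm_conj, RCLike.norm_conj, hT, hζ] at h2
  linarith

/-- On |T| = 1 the numerator of the recursion is T conj ζ times the conjugate of the denominator. -/
theorem norm_pseudoReflection (hα : ∀ j, ‖α j‖ < 1) (hτ : ‖τ‖ = 1) (hζ : ‖ζ‖ = 1)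
    (j : Fin (n + 1)) : ‖pseudoReflection α τ ζ j‖ = 1 := by
  induction j using Fin.reverseInduction with
  | last => rwa [pseudoReflection_last]
  | cast j ih =>
    have hD := conj_mul_add_conj_ne_zero (hα j) ih hζ
    have hT := mul_conj_of_norm_eq_one ih
    have hζ' := mul_conj_of_norm_eq_one hζ
    rw [pseudoReflection_castSucc, norm_div, div_eq_one_iff_eq (norm_ne_zero_iff.mpr hD)]
    set T := pseudoReflection α τ ζ j.succ
    have h1 : conj ζ * α j + T = T * (conj ζ * conj (conj (α j) * T + conj ζ)) := by
      simp only [map_add, map_mul, Complex.conj_conj]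
      linear_combination (-α j * conj ζ) * hT - T * hζ'
    rw [h1, norm_mul, norm_mul, ih, RCLike.norm_conj, RCLike.norm_conj, hζ, one_mul, one_mul]

theorem mul_pseudoReflection_succ (hα : ∀ j, ‖α j‖ < 1) (hτ : ‖τ‖ = 1) (hζ : ‖ζ‖ = 1)
    (j : Fin n) :
    ζ * pseudoReflection α τ ζ j.succ * (1 - conj (α j) * pseudoReflection α τ ζ j.castSucc) =
      pseudoReflection α τ ζ j.castSucc - α j := by
  have hD := conj_mul_add_conj_ne_zero (hα j) (norm_pseudoReflection hα hτ hζ j.succ) hζ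
  have h1 := pseudoReflection_castSucc α τ ζ j
  rw [eq_div_iff hD] at h1
  have hζ' := mul_conj_of_norm_eq_one hζ
  linear_combination -ζ * h1 +
    (pseudoReflection α τ ζ j.castSucc - α j) * hζ'

theorem one_sub_conj_mul_pseudoReflection_ne_zero (hα : ∀ j, ‖α j‖ < 1) (hτ : ‖τ‖ = 1)
    (hζ : ‖ζ‖ = 1) (j : Fin n) (k : Fin (n + 1)) :
    1 - conj (α j) * pseudoReflection α τ ζ k ≠ 0 := by
  apply one_sub_ne_zero_of_norm_lt_one
  rw [norm_mul, RCLike.norm_conj, norm_pseudoReflection hα hτ hζ, mul_one]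
  exact hα j

/-- For the eigenvalue ζ the carry of the row recursion is ζ τ_j y_j, and the initial condition
becomes ζ τ_0 = 1. Contrapositively, the hypothesis on ζ keeps the denominator of β_0 nonzero. -/
theorem mem_spectrum_of_mul_pseudoReflection_zero (hα : ∀ j, ‖α j‖ < 1) (hτ : ‖τ‖ = 1)
    (hζ : ‖ζ‖ = 1) (h : ζ * pseudoReflection α τ ζ 0 = 1) :
    ζ ∈ spectrum ℂ (hessenberg α τ) := by
  let y : Fin (n + 1) → ℂ := Fin.induction (motive := fun _ => ℂ) 1 fun j p =>
    ζ * (1 - conj (α j) * pseudoReflection α τ ζ j.castSucc) * p /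
      (Real.sqrt (1 - ‖α j‖ ^ 2) : ℝ)
  have hy : ∀ j : Fin n, (Real.sqrt (1 - ‖α j‖ ^ 2) : ℝ) * y j.succ =
      ζ * (1 - conj (α j) * pseudoReflection α τ ζ j.castSucc) * y j.castSucc := fun j =>
    mul_div_cancel₀ _ (Complex.ofReal_ne_zero.mpr (sqrt_one_sub_sq_pos (hα j)).ne')
  have hy0 : y 0 = 1 := rfl
  refine mem_spectrum_of_vecMul_eq_smul (y := y) (fun h0 => ?_)
    (vecMul_hessenberg (u := fun j => ζ * pseudoReflection α τ ζ j * y j) ?_ ?_ ?_ ?_)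
  · have := congrFun h0 0
    simp [hy0] at this
  · simp [h]
  · intro j
    rw [hy]
    simp only [Pi.smul_apply, smul_eq_mul]
    ring
  · intro j
    have hρ := Complex.ofReal_ne_zero.mpr (sqrt_one_sub_sq_pos (hα j)).ne'
    have hρ2 := ofReal_sqrt_mul_self (hα j)
    apply mul_left_cancel₀ hρ
    have h1 := mul_pseudoReflection_succ hα hτ hζ j
    linear_combination (ζ * pseudoReflection α τ ζ j.succ + α j) * hy j -
      ζ * pseudoReflection α τ ζ j.castSucc * y j.castSucc * hρ2 + ζ * y j.castSucc * h1
  · have hτ' := mul_conj_of_norm_eq_one hτ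
    rw [pseudoReflection_last]
    simp only [Pi.smul_apply, smul_eq_mul]
    linear_combination (-ζ * y (Fin.last n)) * hτ'

end PseudoReflection

/-! ### Closed form of β and the diagonal of H -/

section Beta

variable {n : ℕ} {α : Fin n → ℂ} {τ ζ s : ℂ}

/-- The squared moduli of the diagonal of the Cholesky factor of twice the Hermitian part:
`h_0 = 1`, `h_{j+1} = ρ_j² / (h_j |1 - conj α_j τ_j|²)`. -/
noncomputable def pivot {n : ℕ} (α : Fin n → ℂ) (τ ζ : ℂ) : Fin (n + 1) → ℝ :=
  Fin.induction (motive := fun _ => ℝ) 1 fun j p =>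
    (1 - ‖α j‖ ^ 2) / (p * ‖1 - conj (α j) * pseudoReflection α τ ζ j.castSucc‖ ^ 2)

theorem pivot_zero (α : Fin n → ℂ) (τ ζ : ℂ) : pivot α τ ζ 0 = 1 := rfl

theorem pivot_succ (α : Fin n → ℂ) (τ ζ : ℂ) (j : Fin n) :
    pivot α τ ζ j.succ = (1 - ‖α j‖ ^ 2) /
      (pivot α τ ζ j.castSucc * ‖1 - conj (α j) * pseudoReflection α τ ζ j.castSucc‖ ^ 2) := rfl

theorem pivot_pos (hα : ∀ j, ‖α j‖ < 1) (hτ : ‖τ‖ = 1) (hζ : ‖ζ‖ = 1) (j : Fin (n + 1)) :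
    0 < pivot α τ ζ j := by
  induction j using Fin.induction with
  | zero => exact one_pos
  | succ j ih =>
    rw [pivot_succ]
    have h1 := norm_pos_iff.mpr (one_sub_conj_mul_pseudoReflection_ne_zero hα hτ hζ j j.castSucc)
    have h2 : 0 < 1 - ‖α j‖ ^ 2 := by nlinarith [hα j, norm_nonneg (α j)]
    positivity

theorem pivot_succ_mul (hα : ∀ j, ‖α j‖ < 1) (hτ : ‖τ‖ = 1) (hζ : ‖ζ‖ = 1) (j : Fin n) :
    (pivot α τ ζ j.succ : ℂ) * pivot α τ ζ j.castSucc *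
      ((1 - conj (α j) * pseudoReflection α τ ζ j.castSucc) *
        (1 - conj (pseudoReflection α τ ζ j.castSucc) * α j)) = 1 - α j * conj (α j) := by
  have hD := one_sub_conj_mul_pseudoReflection_ne_zero hα hτ hζ j j.castSucc
  have hp := (pivot_pos hα hτ hζ j.castSucc).ne'
  have h1 : (1 - conj (α j) * pseudoReflection α τ ζ j.castSucc) *
        (1 - conj (pseudoReflection α τ ζ j.castSucc) * α j) =
      ((‖1 - conj (α j) * pseudoReflection α τ ζ j.castSucc‖ ^ 2 : ℝ) : ℂ) := by
    rw [← Complex.normSq_eq_norm_sq, ← Complex.mul_conj]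
    simp only [map_sub, map_one, map_mul, Complex.conj_conj]
    ring
  have h2 : α j * conj (α j) = ((‖α j‖ ^ 2 : ℝ) : ℂ) := by
    rw [← Complex.normSq_eq_norm_sq, ← Complex.mul_conj]
  rw [h1, h2, pivot_succ]
  norm_cast
  have hD' := norm_ne_zero_iff.mpr hD
  field_simp

theorem beta_zero (α : Fin n → ℂ) (τ ζ s : ℂ) :
    beta α τ ζ s 0 = 1 / (s⁻¹ - pseudoReflection α τ ζ 0 * s) := rfl

theorem norm_sqrt_eq_one (hζ : ‖ζ‖ = 1) (hs : s ^ 2 = ζ) : ‖s‖ = 1 := by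
  have : ‖s‖ ^ 2 = 1 := by rw [← norm_pow, hs, hζ]
  exact (pow_eq_one_iff_of_nonneg (norm_nonneg s) two_ne_zero).mp this

theorem inv_sub_pseudoReflection_mul_ne_zero (hζ : ‖ζ‖ = 1) (hs : s ^ 2 = ζ)
    (h0 : ζ * pseudoReflection α τ ζ 0 ≠ 1) : s⁻¹ - pseudoReflection α τ ζ 0 * s ≠ 0 := by
  intro h
  have hs0 : s ≠ 0 := norm_ne_zero_iff.mp (by rw [norm_sqrt_eq_one hζ hs]; norm_num)
  apply h0
  have := mul_inv_cancel₀ hs0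
  linear_combination this - s * h - pseudoReflection α τ ζ 0 * hs

/-- Although β_{j+1} is defined through 1/β_j, these two factors always combine into s over a
positive pivot, which collapses the recursion to the closed form `beta_succ`. -/
theorem inv_beta_mul (hα : ∀ j, ‖α j‖ < 1) (hτ : ‖τ‖ = 1) (hζ : ‖ζ‖ = 1) (hs : s ^ 2 = ζ)
    (h0 : ζ * pseudoReflection α τ ζ 0 ≠ 1) (j : Fin (n + 1)) :
    1 / beta α τ ζ s j *
      (1 / (conj ζ + pseudoReflection α τ ζ j * conj (shifted α j))) = s / pivot α τ ζ j := by
  have hs1 := norm_sqrt_eq_one hζ hs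
  have hss := mul_conj_of_norm_eq_one hs1
  have hζζ := mul_conj_of_norm_eq_one hζ
  have hs0 : s ≠ 0 := norm_ne_zero_iff.mp (by rw [hs1]; norm_num)
  induction j using Fin.induction with
  | zero =>
    have h1 := inv_sub_pseudoReflection_mul_ne_zero hζ hs h0
    have h2 : conj ζ + pseudoReflection α τ ζ 0 * conj (shifted α 0) =
        conj s * (s⁻¹ - pseudoReflection α τ ζ 0 * s) := by
      have : conj s = s⁻¹ := eq_inv_of_mul_eq_one_right hss
      rw [← hs]
      simp only [shifted, Fin.cons_zero, map_neg, map_one, map_pow, this]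
      field_simp
      ring
    have h3 : conj s ≠ 0 := (map_ne_zero _).mpr hs0
    rw [h2, beta_zero, pivot_zero, Complex.ofReal_one, div_one, one_div_one_div, mul_one_div,
      div_eq_iff (mul_ne_zero h3 h1)]
    linear_combination -(s⁻¹ - pseudoReflection α τ ζ 0 * s) * hss
  | succ j ih =>
    have hb : beta α τ ζ s j.succ = s / pivot α τ ζ j.castSucc *
        (1 / (1 - conj (pseudoReflection α τ ζ j.castSucc) * α j)) := by
      rw [← ih]
      rfl
    have hD := one_sub_conj_mul_pseudoReflection_ne_zero hα hτ hζ j j.castSucc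
    have hD' : 1 - conj (pseudoReflection α τ ζ j.castSucc) * α j ≠ 0 := by
      have := (map_ne_zero conj).mpr hD
      simpa [mul_comm] using this
    have hE := conj_mul_add_conj_ne_zero (hα j) (norm_pseudoReflection hα hτ hζ j.succ) hζ
    have hE' : conj ζ + pseudoReflection α τ ζ j.succ * conj (shifted α j.succ) =
        conj (α j) * pseudoReflection α τ ζ j.succ + conj ζ := by
      simp only [shifted, Fin.cons_succ]
      ring
    have hp := Complex.ofReal_ne_zero.mpr (pivot_pos hα hτ hζ j.castSucc).ne'
    have hq := Complex.ofReal_ne_zero.mpr (pivot_pos hα hτ hζ j.succ).ne'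
    have hm := mul_pseudoReflection_succ hα hτ hζ j
    have hpq := pivot_succ_mul hα hτ hζ j
    rw [hb, hE']
    field_simp
    apply mul_left_cancel₀ hD
    rw [hs]
    linear_combination hpq - conj (α j) * hm -
      (1 - conj (α j) * pseudoReflection α τ ζ j.castSucc) * hζζ

theorem beta_succ (hα : ∀ j, ‖α j‖ < 1) (hτ : ‖τ‖ = 1) (hζ : ‖ζ‖ = 1) (hs : s ^ 2 = ζ)
    (h0 : ζ * pseudoReflection α τ ζ 0 ≠ 1) (j : Fin n) :
    beta α τ ζ s j.succ = s / (pivot α τ ζ j.castSucc *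
        (1 - conj (pseudoReflection α τ ζ j.castSucc) * α j)) := by
  rw [← div_div, ← inv_beta_mul hα hτ hζ hs h0 j.castSucc, div_eq_mul_one_div]
  rfl

/-- The diagonal entries of the dissipative matrix. -/
noncomputable def diagEntry {n : ℕ} (α : Fin n → ℂ) (τ ζ s : ℂ) (j : Fin (n + 1)) : ℂ :=
  s * conj (beta α τ ζ s j)

theorem diagEntry_zero_mul (hζ : ‖ζ‖ = 1) (hs : s ^ 2 = ζ)
    (h0 : ζ * pseudoReflection α τ ζ 0 ≠ 1) :
    conj (diagEntry α τ ζ s 0) * (1 - ζ * pseudoReflection α τ ζ 0) = 1 := by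
  have h1 := inv_sub_pseudoReflection_mul_ne_zero hζ hs h0
  have hs1 := norm_sqrt_eq_one hζ hs
  have hss := mul_conj_of_norm_eq_one hs1
  have hs0 : s ≠ 0 := norm_ne_zero_iff.mp (by rw [hs1]; norm_num)
  have : conj s = s⁻¹ := eq_inv_of_mul_eq_one_right hss
  rw [diagEntry, beta_zero, map_mul, Complex.conj_conj, this, mul_assoc, one_div,
    inv_mul_eq_div, inv_mul_eq_div, div_div, div_eq_one_iff_eq (mul_ne_zero h1 hs0), ← hs]
  field_simp

theorem diagEntry_succ_mul (hα : ∀ j, ‖α j‖ < 1) (hτ : ‖τ‖ = 1) (hζ : ‖ζ‖ = 1)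
    (hs : s ^ 2 = ζ) (h0 : ζ * pseudoReflection α τ ζ 0 ≠ 1) (j : Fin n) :
    diagEntry α τ ζ s j.succ * (pivot α τ ζ j.castSucc *
        (1 - conj (α j) * pseudoReflection α τ ζ j.castSucc)) = 1 := by
  have hD := one_sub_conj_mul_pseudoReflection_ne_zero hα hτ hζ j j.castSucc
  have hp := Complex.ofReal_ne_zero.mpr (pivot_pos hα hτ hζ j.castSucc).ne'
  have hss := mul_conj_of_norm_eq_one (norm_sqrt_eq_one hζ hs)
  rw [diagEntry, beta_succ hα hτ hζ hs h0]
  simp only [map_div₀, map_mul, map_sub, map_one, Complex.conj_conj, Complex.conj_ofReal]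
  rw [mul_comm (conj (α j))] at hD ⊢
  field_simp
  exact hss

theorem diagEntry_zero_add_conj (hα : ∀ j, ‖α j‖ < 1) (hτ : ‖τ‖ = 1) (hζ : ‖ζ‖ = 1)
    (hs : s ^ 2 = ζ) (h0 : ζ * pseudoReflection α τ ζ 0 ≠ 1) :
    diagEntry α τ ζ s 0 + conj (diagEntry α τ ζ s 0) = pivot α τ ζ 0 := by
  have h1 := diagEntry_zero_mul hζ hs h0
  have h2 := congrArg conj h1
  have hT := mul_conj_of_norm_eq_one (norm_pseudoReflection hα hτ hζ 0)
  have hζζ := mul_conj_of_norm_eq_one hζ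
  simp only [map_mul, map_sub, map_one, Complex.conj_conj] at h2
  have hne : 1 - ζ * pseudoReflection α τ ζ 0 ≠ 0 := sub_ne_zero.mpr h0.symm
  have hne' : 1 - conj ζ * conj (pseudoReflection α τ ζ 0) ≠ 0 := by
    have := (map_ne_zero conj).mpr hne
    simpa using this
  rw [eq_div_of_mul_eq hne h1, eq_div_of_mul_eq hne' h2, pivot_zero]
  push_cast
  field_simp
  linear_combination (-ζ * conj ζ) * hT - hζζ

/-- With z = conj α_j τ_j, so that |z| = |α_j|, one has 2 - 2 Re z = |1 - z|² + (1 - |z|²). Division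
by h_j |1 - z|² yields 1/h_j and the next pivot. -/
theorem diagEntry_succ_add_conj (hα : ∀ j, ‖α j‖ < 1) (hτ : ‖τ‖ = 1) (hζ : ‖ζ‖ = 1)
    (hs : s ^ 2 = ζ) (h0 : ζ * pseudoReflection α τ ζ 0 ≠ 1) (j : Fin n) :
    diagEntry α τ ζ s j.succ + conj (diagEntry α τ ζ s j.succ) =
      pivot α τ ζ j.succ + 1 / pivot α τ ζ j.castSucc := by
  have h1 := diagEntry_succ_mul hα hτ hζ hs h0 j
  have h2 := congrArg conj h1
  simp only [map_mul, map_sub, map_one, Complex.conj_conj, Complex.conj_ofReal] at h2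
  have hD := one_sub_conj_mul_pseudoReflection_ne_zero hα hτ hζ j j.castSucc
  have hD' : 1 - α j * conj (pseudoReflection α τ ζ j.castSucc) ≠ 0 := by
    have := (map_ne_zero conj).mpr hD
    simpa [mul_comm] using this
  have hp := Complex.ofReal_ne_zero.mpr (pivot_pos hα hτ hζ j.castSucc).ne'
  have hT := mul_conj_of_norm_eq_one (norm_pseudoReflection hα hτ hζ j.castSucc)
  have hpq := pivot_succ_mul hα hτ hζ j
  rw [eq_div_of_mul_eq (mul_ne_zero hp hD') h2, eq_div_of_mul_eq (mul_ne_zero hp hD) h1]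
  field_simp
  linear_combination -hpq - α j * conj (α j) * hT

end Beta

end Popuc

/-! ### The tridiagonal pencil A* + wA -/

namespace Popuc

open Matrix ComplexConjugate
open scoped ComplexOrder

section Pencil

variable {n : ℕ} {α : Fin n → ℂ} {τ ζ s : ℂ}

/-- The sequence shifted to the left, with a zero at the end. -/
def next {n : ℕ} (x : Fin (n + 1) → ℂ) : Fin (n + 1) → ℂ :=
  Fin.snoc (α := fun _ => ℂ) (fun j : Fin n => x j.succ) 0

/-- The sequence shifted to the right, with a zero at the beginning. -/
def prev {n : ℕ} (x : Fin (n + 1) → ℂ) : Fin (n + 1) → ℂ :=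
  Fin.cons (α := fun _ => ℂ) 0 fun j : Fin n => x j.castSucc

@[simp] theorem next_castSucc (x : Fin (n + 1) → ℂ) (j : Fin n) :
    next x j.castSucc = x j.succ := by simp [next]

@[simp] theorem next_last (x : Fin (n + 1) → ℂ) : next x (Fin.last n) = 0 := by simp [next]

@[simp] theorem prev_succ (x : Fin (n + 1) → ℂ) (j : Fin n) :
    prev x j.succ = x j.castSucc := by simp [prev]

@[simp] theorem prev_zero (x : Fin (n + 1) → ℂ) : prev x 0 = 0 := by simp [prev]

theorem sum_mul_prev (x y : Fin (n + 1) → ℂ) : ∑ j, x j * prev y j = ∑ j, next x j * y j := by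
  rw [Fin.sum_univ_succ, Fin.sum_univ_castSucc (fun j => next x j * y j)]
  simp

theorem dissipative_apply (α : Fin n → ℂ) (τ ζ s : ℂ) (i k : Fin (n + 1)) :
    dissipative α τ ζ s i k = (if i = k then diagEntry α τ ζ s i else 0) +
      (if (i : ℕ) = (k : ℕ) + 1 then -s else 0) := by
  simp only [dissipative, diagEntry, Matrix.smul_apply, Matrix.of_apply, smul_eq_mul]
  by_cases h : i = k
  · subst h
    simp
  · simp [h]

theorem sum_ite_eq_succ (i : Fin (n + 1)) (x : Fin (n + 1) → ℂ) :
    ∑ k : Fin (n + 1), (if (i : ℕ) = (k : ℕ) + 1 then x k else 0) = prev x i := by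
  induction i using Fin.cases with
  | zero => simp
  | succ j =>
    rw [Finset.sum_eq_single j.castSucc]
    · simp
    · intro k _ hk
      have : ¬ (j.succ : ℕ) = (k : ℕ) + 1 := by
        intro h
        apply hk
        ext
        simp at h ⊢
        omega
      rw [if_neg this]
    · simp

theorem sum_ite_succ_eq (i : Fin (n + 1)) (x : Fin (n + 1) → ℂ) :
    ∑ k : Fin (n + 1), (if (k : ℕ) = (i : ℕ) + 1 then x k else 0) = next x i := by
  induction i using Fin.lastCases with
  | last =>
    rw [next_last]
    refine Finset.sum_eq_zero fun k _ => if_neg ?_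
    simpa using k.is_lt.ne
  | cast j =>
    rw [Finset.sum_eq_single j.succ]
    · simp
    · intro k _ hk
      refine if_neg fun h => hk ?_
      ext
      simpa using h
    · simp

theorem dissipative_mulVec (α : Fin n → ℂ) (τ ζ s : ℂ) (x : Fin (n + 1) → ℂ) (i : Fin (n + 1)) :
    (dissipative α τ ζ s *ᵥ x) i = diagEntry α τ ζ s i * x i - s * prev x i := by
  simp only [mulVec, dotProduct, dissipative_apply, add_mul, ite_mul, zero_mul,
    Finset.sum_add_distrib, Finset.sum_ite_eq, Finset.mem_univ, if_true, sub_eq_add_neg,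
    ← neg_mul, add_right_inj]
  rw [← sum_ite_eq_succ, Finset.mul_sum]
  exact Finset.sum_congr rfl fun k _ => by rw [mul_ite, mul_zero]

theorem conjTranspose_dissipative_mulVec (α : Fin n → ℂ) (τ ζ s : ℂ) (x : Fin (n + 1) → ℂ)
    (i : Fin (n + 1)) :
    ((dissipative α τ ζ s)ᴴ *ᵥ x) i = conj (diagEntry α τ ζ s i) * x i - conj s * next x i := by
  have h : ∀ k, star (dissipative α τ ζ s k i) = (if i = k then conj (diagEntry α τ ζ s i) else 0) +
      (if (k : ℕ) = (i : ℕ) + 1 then -conj s else 0) := by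
    intro k
    rw [dissipative_apply, star_add]
    congr 1
    · by_cases hk : k = i
      · subst hk
        simp
      · simp [hk, Ne.symm hk]
    · split_ifs <;> simp
  simp only [mulVec, dotProduct, conjTranspose_apply, h, add_mul, ite_mul, zero_mul,
    Finset.sum_add_distrib, Finset.sum_ite_eq, Finset.mem_univ, if_true, sub_eq_add_neg,
    ← neg_mul, add_right_inj]
  rw [← sum_ite_succ_eq, Finset.mul_sum]
  exact Finset.sum_congr rfl fun k _ => by rw [mul_ite, mul_zero]

/-- The image of `x` under the upper triangular factor of twice the Hermitian part. -/
noncomputable def elim {n : ℕ} (α : Fin n → ℂ) (τ ζ s : ℂ) (x : Fin (n + 1) → ℂ)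
    (j : Fin (n + 1)) : ℂ :=
  pivot α τ ζ j * x j - conj s * next x j

theorem eq_zero_of_elim_eq_zero (hα : ∀ j, ‖α j‖ < 1) (hτ : ‖τ‖ = 1) (hζ : ‖ζ‖ = 1)
    {x : Fin (n + 1) → ℂ} (h : ∀ j, elim α τ ζ s x j = 0) : x = 0 := by
  have hp := fun j => Complex.ofReal_ne_zero.mpr (pivot_pos hα hτ hζ j).ne'
  funext j
  induction j using Fin.reverseInduction with
  | last => simpa [elim, hp] using h (Fin.last n)
  | cast j ih => simpa [elim, hp, ih] using h j.castSucc

/-- Completing squares: 2H = U* D⁻¹ U, where U is the map `elim` and D is the diagonal matrix of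
pivots. -/
theorem dotProduct_hermitianPart_mulVec (hα : ∀ j, ‖α j‖ < 1) (hτ : ‖τ‖ = 1) (hζ : ‖ζ‖ = 1)
    (hs : s ^ 2 = ζ) (h0 : ζ * pseudoReflection α τ ζ 0 ≠ 1) (x : Fin (n + 1) → ℂ) :
    star x ⬝ᵥ hermitianPart α τ ζ s *ᵥ x =
      ((∑ j, ‖elim α τ ζ s x j‖ ^ 2 / (2 * pivot α τ ζ j) : ℝ) : ℂ) := by
  have hp := fun j => Complex.ofReal_ne_zero.mpr (pivot_pos hα hτ hζ j).ne'
  have hss := mul_conj_of_norm_eq_one (norm_sqrt_eq_one hζ hs)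
  -- This is D⁻¹Ux, so that `hrow` reads 2Hx = U*g.
  let g : Fin (n + 1) → ℂ := fun j => elim α τ ζ s x j / pivot α τ ζ j
  have hrow : ∀ i, (hermitianPart α τ ζ s *ᵥ x) i =
      (1 / 2) * (elim α τ ζ s x i - s * prev g i) := by
    intro i
    rw [hermitianPart, smul_mulVec, add_mulVec, Pi.smul_apply, Pi.add_apply, dissipative_mulVec,
      conjTranspose_dissipative_mulVec, smul_eq_mul]
    congr 1
    induction i using Fin.cases with
    | zero =>
      have := diagEntry_zero_add_conj hα hτ hζ hs h0
      simp only [elim, prev_zero]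
      linear_combination x 0 * this
    | succ j =>
      have := diagEntry_succ_add_conj hα hτ hζ hs h0 j
      have hg : g j.castSucc = x j.castSucc - conj s * x j.succ / pivot α τ ζ j.castSucc := by
        simp only [g, elim, next_castSucc]
        field_simp [hp j.castSucc]
      rw [prev_succ, prev_succ, hg]
      simp only [elim]
      linear_combination x j.succ * this - x j.succ / pivot α τ ζ j.castSucc * hss
  have h1 : star x ⬝ᵥ hermitianPart α τ ζ s *ᵥ x =
      (1 / 2) * (∑ i, conj (x i) * elim α τ ζ s x i -
        s * ∑ i, conj (x i) * prev g i) := by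
    rw [Finset.mul_sum, ← Finset.sum_sub_distrib, Finset.mul_sum, dotProduct]
    refine Finset.sum_congr rfl fun i _ => ?_
    rw [hrow, Pi.star_apply, Complex.star_def]
    ring
  have hnext : ∀ j, next (fun i => conj (x i)) j = conj (next x j) := by
    intro j
    induction j using Fin.lastCases with
    | last => simp
    | cast j => simp
  rw [h1, sum_mul_prev, Finset.mul_sum, ← Finset.sum_sub_distrib, Finset.mul_sum]
  push_cast
  refine Finset.sum_congr rfl fun j _ => ?_
  have h2 : ((‖elim α τ ζ s x j‖ : ℝ) : ℂ) ^ 2 =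
      elim α τ ζ s x j * conj (elim α τ ζ s x j) := by
    rw [Complex.mul_conj, Complex.normSq_eq_norm_sq]
    push_cast
    rfl
  have h3 : conj (elim α τ ζ s x j) = pivot α τ ζ j * conj (x j) - s * conj (next x j) := by
    simp [elim]
  rw [h2, h3, hnext]
  simp only [g]
  field_simp [hp j]

theorem isHermitian_hermitianPart : (hermitianPart α τ ζ s).IsHermitian := by
  rw [IsHermitian, hermitianPart, conjTranspose_smul, conjTranspose_add,
    conjTranspose_conjTranspose, add_comm (dissipative α τ ζ s)ᴴ]
  simp

theorem posDef_hermitianPart (hα : ∀ j, ‖α j‖ < 1) (hτ : ‖τ‖ = 1) (hζ : ‖ζ‖ = 1)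
    (hs : s ^ 2 = ζ) (h0 : ζ * pseudoReflection α τ ζ 0 ≠ 1) :
    (hermitianPart α τ ζ s).PosDef := by
  refine Matrix.PosDef.of_dotProduct_mulVec_pos isHermitian_hermitianPart fun x hx => ?_
  rw [dotProduct_hermitianPart_mulVec hα hτ hζ hs h0]
  rw [Complex.zero_lt_real]
  have hp := fun j => pivot_pos hα hτ hζ j
  obtain ⟨j, hj⟩ : ∃ j, elim α τ ζ s x j ≠ 0 := by
    by_contra! h
    exact hx (eq_zero_of_elim_eq_zero hα hτ hζ h)
  have hj' := norm_pos_iff.mpr hj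
  refine Finset.sum_pos' (fun k _ => ?_) ⟨j, Finset.mem_univ _, ?_⟩
  · have := hp k
    positivity
  · have := hp j
    positivity

theorem pencil_mulVec_apply (w : ℂ) (x : Fin (n + 1) → ℂ) (j : Fin (n + 1)) :
    (((dissipative α τ ζ s)ᴴ + w • dissipative α τ ζ s) *ᵥ x) j =
      (conj (diagEntry α τ ζ s j) + w * diagEntry α τ ζ s j) * x j - conj s * next x j -
        w * s * prev x j := by
  rw [add_mulVec, smul_mulVec, Pi.add_apply, Pi.smul_apply, dissipative_mulVec,
    conjTranspose_dissipative_mulVec, smul_eq_mul]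
  ring

/-- Row j determines x_{j+1} from x_j and x_{j-1}, the superdiagonal entry -conj s being nonzero; a
kernel vector is thus fixed by its coordinate 0. -/
theorem eq_zero_of_pencil_mulVec_eq_zero (hs0 : s ≠ 0) {w : ℂ} {x : Fin (n + 1) → ℂ}
    (h : ((dissipative α τ ζ s)ᴴ + w • dissipative α τ ζ s) *ᵥ x = 0) (hx0 : x 0 = 0) :
    x = 0 := by
  have hs0' : conj s ≠ 0 := (map_ne_zero _).mpr hs0
  suffices H : ∀ j, x j = 0 ∧ prev x j = 0 from funext fun j => (H j).1
  intro j
  induction j using Fin.induction with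
  | zero => exact ⟨hx0, prev_zero x⟩
  | succ j ih =>
    refine ⟨?_, by rw [prev_succ, ih.1]⟩
    have hr := congrFun h j.castSucc
    rw [pencil_mulVec_apply, ih.1, ih.2, next_castSucc] at hr
    simpa [hs0'] using hr

/-- The scaling between kernel vectors of the pencil and left eigenvectors of the Hessenberg
matrix. -/
noncomputable def scaling {n : ℕ} (α : Fin n → ℂ) (τ ζ s : ℂ) : Fin (n + 1) → ℂ :=
  Fin.induction (motive := fun _ => ℂ) 1 fun j a =>
    (Real.sqrt (1 - ‖α j‖ ^ 2) : ℝ) * a /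
      (s * pivot α τ ζ j.castSucc * (1 - conj (α j) * pseudoReflection α τ ζ j.castSucc))

theorem scaling_succ (α : Fin n → ℂ) (τ ζ s : ℂ) (j : Fin n) :
    scaling α τ ζ s j.succ = (Real.sqrt (1 - ‖α j‖ ^ 2) : ℝ) * scaling α τ ζ s j.castSucc /
      (s * pivot α τ ζ j.castSucc * (1 - conj (α j) * pseudoReflection α τ ζ j.castSucc)) := rfl

theorem scaling_ne_zero (hα : ∀ j, ‖α j‖ < 1) (hτ : ‖τ‖ = 1) (hζ : ‖ζ‖ = 1) (hs0 : s ≠ 0)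
    (j : Fin (n + 1)) : scaling α τ ζ s j ≠ 0 := by
  induction j using Fin.induction with
  | zero => exact one_ne_zero
  | succ j ih =>
    rw [scaling_succ]
    have hD := one_sub_conj_mul_pseudoReflection_ne_zero hα hτ hζ j j.castSucc
    have hp := Complex.ofReal_ne_zero.mpr (pivot_pos hα hτ hζ j.castSucc).ne'
    have hρ := Complex.ofReal_ne_zero.mpr (sqrt_one_sub_sq_pos (hα j)).ne'
    exact div_ne_zero (mul_ne_zero hρ ih) (mul_ne_zero (mul_ne_zero hs0 hp) hD)

theorem mem_spectrum_of_pencil_mulVec_eq_zero (hα : ∀ j, ‖α j‖ < 1) (hτ : ‖τ‖ = 1)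
    (hζ : ‖ζ‖ = 1) (hs : s ^ 2 = ζ) (h0 : ζ * pseudoReflection α τ ζ 0 ≠ 1) {w : ℂ}
    {x : Fin (n + 1) → ℂ} (hx : x ≠ 0)
    (h : ((dissipative α τ ζ s)ᴴ + w • dissipative α τ ζ s) *ᵥ x = 0) :
    ζ * w ∈ spectrum ℂ (hessenberg α τ) := by
  have hs1 := norm_sqrt_eq_one hζ hs
  have hs0 : s ≠ 0 := norm_ne_zero_iff.mp (by rw [hs1]; norm_num)
  have hss := mul_conj_of_norm_eq_one hs1
  have hζs : ζ * conj s = s := by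
    rw [← hs]
    linear_combination s * hss
  have ha := fun j => scaling_ne_zero (s := s) hα hτ hζ hs0 j
  have hp := fun j => Complex.ofReal_ne_zero.mpr (pivot_pos hα hτ hζ j).ne'
  have hrow : ∀ j, (conj (diagEntry α τ ζ s j) + w * diagEntry α τ ζ s j) * x j -
      conj s * next x j - w * s * prev x j = 0 := fun j => by
    rw [← pencil_mulVec_apply, h, Pi.zero_apply]
  set a := scaling α τ ζ s with hadef
  set T := pseudoReflection α τ ζ with hT
  set d := diagEntry α τ ζ s with hd
  set p := pivot α τ ζ with hpdef
  let y : Fin (n + 1) → ℂ := fun j => elim α τ ζ s x j / a j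
  -- For w = 1 this carry is ζ τ_j y_j, the ansatz of `mem_spectrum_of_mul_pseudoReflection_zero`;
  -- for general w the factor w goes with x_j only.
  let u : Fin (n + 1) → ℂ := fun j => ζ * T j * (w * p j * x j - conj s * next x j) / a j
  -- The scaling is built to absorb ρ_j: both recursions get the common denominator a_j and become
  -- polynomial identities modulo the pencil rows.
  have hρa : ∀ j : Fin n, (Real.sqrt (1 - ‖α j‖ ^ 2) : ℝ) / a j.succ =
      s * p j.castSucc * (1 - conj (α j) * T j.castSucc) / a j.castSucc := by
    intro j
    have hD := one_sub_conj_mul_pseudoReflection_ne_zero hα hτ hζ j j.castSucc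
    have hρ := Complex.ofReal_ne_zero.mpr (sqrt_one_sub_sq_pos (hα j)).ne'
    have h1 := ha j.castSucc
    have h2 := hp j.castSucc
    rw [← hT] at hD
    rw [hadef, scaling_succ, ← hadef, ← hpdef, ← hT]
    field_simp
  have hstep1 : ∀ j : Fin n, (Real.sqrt (1 - ‖α j‖ ^ 2) : ℝ) * y j.succ =
      ζ * w * y j.castSucc - conj (α j) * u j.castSucc := by
    intro j
    have e1 : (Real.sqrt (1 - ‖α j‖ ^ 2) : ℝ) * y j.succ =
        s * p j.castSucc * (1 - conj (α j) * T j.castSucc) * elim α τ ζ s x j.succ /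
          a j.castSucc := by
      simp only [y]
      rw [mul_div_assoc', mul_div_right_comm, hρa]
      ring
    have e2 : ζ * w * y j.castSucc - conj (α j) * u j.castSucc =
        (ζ * w * elim α τ ζ s x j.castSucc - conj (α j) *
          (ζ * T j.castSucc * (w * p j.castSucc * x j.castSucc - conj s * x j.succ))) /
            a j.castSucc := by
      simp only [y, u, next_castSucc]
      ring
    rw [e1, e2]
    congr 1
    have hr := hrow j.succ
    rw [prev_succ] at hr
    have hd1 := diagEntry_succ_mul hα hτ hζ hs h0 j
    have hd2 := diagEntry_succ_add_conj hα hτ hζ hs h0 j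
    rw [← hd, ← hpdef] at hd2
    rw [← hd, ← hpdef, ← hT] at hd1
    have hpp : (p j.castSucc : ℂ) * (1 / p j.castSucc) = 1 := mul_one_div_cancel (hp _)
    simp only [elim, next_castSucc, ← hpdef]
    linear_combination s * p j.castSucc * (1 - conj (α j) * T j.castSucc) * hr -
      s * p j.castSucc * (1 - conj (α j) * T j.castSucc) * x j.succ * hd2 +
      s * (1 - w) * x j.succ * hd1 - s * (1 - conj (α j) * T j.castSucc) * x j.succ * hpp +
      w * p j.castSucc * (1 - conj (α j) * T j.castSucc) * x j.castSucc * hs +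
      (w - conj (α j) * T j.castSucc) * x j.succ * hζs
  -- The second row recursion with `hstep1` inserted and ρ_j² = 1 - |α_j|² used; this form has no
  -- ρ_j² and is converted back below.
  have hstep2 : ∀ j : Fin n, (Real.sqrt (1 - ‖α j‖ ^ 2) : ℝ) * u j.succ =
      u j.castSucc - α j * (ζ * w) * y j.castSucc := by
    intro j
    have e1 : (Real.sqrt (1 - ‖α j‖ ^ 2) : ℝ) * u j.succ =
        s * p j.castSucc * (1 - conj (α j) * T j.castSucc) *
          (ζ * T j.succ * (w * p j.succ * x j.succ - conj s * next x j.succ)) /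
          a j.castSucc := by
      simp only [u]
      rw [mul_div_assoc', mul_div_right_comm, hρa]
      ring
    have e2 : u j.castSucc - α j * (ζ * w) * y j.castSucc =
        (ζ * T j.castSucc * (w * p j.castSucc * x j.castSucc - conj s * x j.succ) -
          α j * (ζ * w) * elim α τ ζ s x j.castSucc) / a j.castSucc := by
      simp only [y, u, next_castSucc]
      ring
    rw [e1, e2]
    congr 1
    have hr := hrow j.succ
    rw [prev_succ] at hr
    have hd1 := congrArg conj (diagEntry_succ_mul hα hτ hζ hs h0 j)
    have hd2 := diagEntry_succ_add_conj hα hτ hζ hs h0 j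
    rw [← hd, ← hpdef] at hd2
    rw [← hd, ← hpdef, ← hT] at hd1
    simp only [map_mul, map_sub, map_one, Complex.conj_conj, Complex.conj_ofReal] at hd1
    have hpp : (p j.castSucc : ℂ) * (1 / p j.castSucc) = 1 := mul_one_div_cancel (hp _)
    have hm := mul_pseudoReflection_succ hα hτ hζ j
    have hTT := mul_conj_of_norm_eq_one (norm_pseudoReflection hα hτ hζ j.castSucc)
    rw [← hT] at hm hTT
    simp only [elim, next_castSucc, ← hpdef]
    linear_combination
      s * p j.castSucc * (w * p j.succ * x j.succ - conj s * next x j.succ) * hm +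
      s * p j.castSucc * (T j.castSucc - α j) * hr -
      s * p j.castSucc * (T j.castSucc - α j) * w * x j.succ * hd2 -
      s * p j.castSucc * (1 - w) * conj (d j.succ) * x j.succ * α j * hTT -
      s * (1 - w) * x j.succ * T j.castSucc * hd1 -
      s * (T j.castSucc - α j) * w * x j.succ * hpp +
      w * p j.castSucc * (T j.castSucc - α j) * x j.castSucc * hs +
      (T j.castSucc - α j * w) * x j.succ * hζs
  refine mem_spectrum_of_vecMul_eq_smul (y := y) (fun hy => hx ?_)
    (vecMul_hessenberg (u := u) ?_ ?_ ?_ ?_)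
  · refine eq_zero_of_elim_eq_zero (s := s) hα hτ hζ fun j => ?_
    have := congrFun hy j
    simpa [y, ha j] using this
  · have hr := hrow 0
    have hd0 := diagEntry_zero_mul hζ hs h0
    have hd0' := diagEntry_zero_add_conj hα hτ hζ hs h0
    rw [← hd, ← hT] at hd0
    rw [← hd, pivot_zero] at hd0'
    simp only [u, y, elim, ← hpdef]
    congr 1
    rw [prev_zero] at hr
    have hp0 : p 0 = 1 := pivot_zero α τ ζ
    rw [hp0]
    push_cast at hd0' ⊢
    linear_combination -(1 - ζ * T 0) * hr + x 0 * hd0 + w * (1 - ζ * T 0) * x 0 * hd0' -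
      w * x 0 * hd0
  · intro j
    rw [hstep1]
    simp
  · intro j
    have hρ := Complex.ofReal_ne_zero.mpr (sqrt_one_sub_sq_pos (hα j)).ne'
    have hρ2 := ofReal_sqrt_mul_self (hα j)
    apply mul_left_cancel₀ hρ
    linear_combination hstep2 j + α j * hstep1 j - u j.castSucc * hρ2
  · have hτ' := mul_conj_of_norm_eq_one hτ
    simp only [u, y, elim, next_last, Pi.smul_apply, smul_eq_mul, hT, pseudoReflection_last,
      ← hpdef]
    linear_combination (-ζ * w * p (Fin.last n) * x (Fin.last n) / a (Fin.last n)) * hτ'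

end Pencil

end Popuc

/-! ### The matrix K and its dependence on the parameters -/

namespace Popuc

open Matrix ComplexConjugate
open scoped ComplexOrder

section SkewPart

variable {n : ℕ} {α : Fin n → ℂ} {τ ζ s : ℂ}

/-- The matrix `K` in the Toeplitz decomposition `A = H + i K`. -/
noncomputable def skewPart {n : ℕ} (α : Fin n → ℂ) (τ ζ s : ℂ) :
    Matrix (Fin (n + 1)) (Fin (n + 1)) ℂ :=
  (-(Complex.I / 2)) • (dissipative α τ ζ s - (dissipative α τ ζ s)ᴴ)

theorem isHermitian_skewPart : (skewPart α τ ζ s).IsHermitian := by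
  rw [IsHermitian, skewPart, conjTranspose_smul, conjTranspose_sub, conjTranspose_conjTranspose,
    ← neg_sub (dissipative α τ ζ s), smul_neg, ← neg_smul]
  congr 1
  simp [neg_div]

/-- The subdiagonal entries of A are the constant -s, so K varies only through its diagonal. -/
theorem skewPart_sub_skewPart {α' : Fin n → ℂ} {τ' : ℂ} :
    skewPart α τ ζ s - skewPart α' τ' ζ s = diagonal fun j =>
      (((diagEntry α τ ζ s j).im - (diagEntry α' τ' ζ s j).im : ℝ) : ℂ) := by
  ext i k
  have hc : ∀ d : ℂ, -(Complex.I / 2) * (d - conj d) = (d.im : ℂ) := by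
    intro d
    rw [Complex.sub_conj]
    push_cast
    linear_combination (-(d.im : ℂ)) * Complex.I_mul_I
  simp only [skewPart, Matrix.sub_apply, Matrix.smul_apply, conjTranspose_apply, smul_eq_mul,
    dissipative_apply, star_add]
  by_cases h : i = k
  · subst h
    have h1 := hc (diagEntry α τ ζ s i)
    have h2 := hc (diagEntry α' τ' ζ s i)
    simp [h1, h2]
  · simp [h, Ne.symm h]

theorem re_dotProduct_skewPart_mulVec_sub {α' : Fin n → ℂ} {τ' : ℂ} (x : Fin (n + 1) → ℂ) :
    (star x ⬝ᵥ skewPart α τ ζ s *ᵥ x).re - (star x ⬝ᵥ skewPart α' τ' ζ s *ᵥ x).re =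
      ∑ j, ((diagEntry α τ ζ s j).im - (diagEntry α' τ' ζ s j).im) * ‖x j‖ ^ 2 := by
  rw [← Complex.sub_re, ← dotProduct_sub, ← sub_mulVec, skewPart_sub_skewPart, dotProduct,
    Complex.re_sum]
  refine Finset.sum_congr rfl fun j _ => ?_
  rw [mulVec_diagonal, Pi.star_apply, Complex.star_def, mul_left_comm, mul_comm (conj (x j)),
    Complex.mul_conj, Complex.normSq_eq_norm_sq, ← Complex.ofReal_mul, Complex.ofReal_re]

theorem ofReal_sub_I_ne_zero (c : ℝ) : (c : ℂ) - Complex.I ≠ 0 := by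
  intro h
  simpa using congrArg Complex.im h

/-- Here Ax = (1 + ic)Hx and A*x = (1 - ic)Hx, and the coefficient of A is -(1 - ic)/(1 + ic). -/
theorem pencil_mulVec_eq_zero_of_skewPart {c : ℝ} {x : Fin (n + 1) → ℂ}
    (h : skewPart α τ ζ s *ᵥ x = (c : ℂ) • hermitianPart α τ ζ s *ᵥ x) :
    ((dissipative α τ ζ s)ᴴ +
      (((c : ℂ) + Complex.I) / ((c : ℂ) - Complex.I)) • dissipative α τ ζ s) *ᵥ x = 0 := by
  funext j
  have hj := congrFun h j
  have hc := ofReal_sub_I_ne_zero c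
  simp only [skewPart, hermitianPart, smul_mulVec, sub_mulVec, add_mulVec, Pi.smul_apply,
    Pi.sub_apply, Pi.add_apply, smul_eq_mul, Pi.zero_apply] at hj ⊢
  field_simp
  linear_combination -2 * hj

theorem im_inv_mul_beta (hs1 : ‖s‖ = 1) (j : Fin (n + 1)) :
    (s⁻¹ * beta α τ ζ s j).im = -(diagEntry α τ ζ s j).im := by
  have h : conj s = s⁻¹ := eq_inv_of_mul_eq_one_right (mul_conj_of_norm_eq_one hs1)
  rw [← Complex.conj_im, diagEntry, map_mul, Complex.conj_conj, h]

end SkewPart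

/-! ### Cayley transform and linear algebra tools -/

/-- An explicit argument of the Cayley transform, continuous and strictly decreasing on the whole
line, so the angles need no lifting argument. -/
theorem exp_pi_sub_two_mul_arctan (c : ℝ) :
    Complex.exp (((Real.pi - 2 * Real.arctan c : ℝ) : ℂ) * Complex.I) =
      ((c : ℂ) + Complex.I) / ((c : ℂ) - Complex.I) := by
  have hpos : 0 < 1 + c ^ 2 := by positivity
  have h1 : ((Real.sqrt (1 + c ^ 2) : ℝ) : ℂ) ≠ 0 :=
    Complex.ofReal_ne_zero.mpr (Real.sqrt_pos.mpr hpos).ne'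
  have h2 : ((Real.sqrt (1 + c ^ 2) : ℝ) : ℂ) ^ 2 = 1 + (c : ℂ) ^ 2 := by
    rw [← Complex.ofReal_pow, Real.sq_sqrt hpos.le]
    push_cast
    rfl
  have h3 : Complex.exp (((-Real.arctan c : ℝ) : ℂ) * Complex.I) =
      (1 - (c : ℂ) * Complex.I) / (Real.sqrt (1 + c ^ 2) : ℝ) := by
    rw [Complex.exp_mul_I, ← Complex.ofReal_cos, ← Complex.ofReal_sin, Real.cos_neg, Real.sin_neg,
      Real.cos_arctan, Real.sin_arctan]
    push_cast
    ring
  have h4 : ((Real.pi - 2 * Real.arctan c : ℝ) : ℂ) * Complex.I = (Real.pi : ℂ) * Complex.I +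
      (((-Real.arctan c : ℝ) : ℂ) * Complex.I + ((-Real.arctan c : ℝ) : ℂ) * Complex.I) := by
    push_cast
    ring
  rw [h4, Complex.exp_add, Complex.exp_add, Complex.exp_pi_mul_I, h3,
    eq_div_iff (ofReal_sub_I_ne_zero c), div_mul_div_comm, ← sq, ← sq, h2]
  have h5 : (1 + (c : ℂ) ^ 2) ≠ 0 := by rw [← h2]; exact pow_ne_zero 2 h1
  have hI := Complex.I_sq
  field_simp
  linear_combination ((c : ℂ) ^ 2 * Complex.I - (c : ℂ) ^ 3 - 2 * (c : ℂ)) * hI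

theorem ofReal_add_I_div_sub_I_injective :
    Function.Injective fun c : ℝ => ((c : ℂ) + Complex.I) / ((c : ℂ) - Complex.I) := by
  intro a b h
  simp only at h
  rw [div_eq_div_iff (ofReal_sub_I_ne_zero a) (ofReal_sub_I_ne_zero b)] at h
  have h1 : (2 * Complex.I) * ((a : ℂ) - b) = 0 := by linear_combination -h
  have h2 : (2 * Complex.I) ≠ 0 := by simp
  exact_mod_cast sub_eq_zero.mp ((mul_eq_zero.mp h1).resolve_left h2)

theorem exists_eq_conjTranspose_mul_self {m : Type*} [Fintype m] [DecidableEq m]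
    {H : Matrix m m ℂ} (hH : H.PosDef) : ∃ C : Matrix m m ℂ, IsUnit C.det ∧ H = Cᴴ * C := by
  open scoped MatrixOrder in
  obtain ⟨C, hC⟩ := CStarAlgebra.nonneg_iff_eq_star_mul_self.mp hH.posSemidef.nonneg
  refine ⟨C, ?_, hC⟩
  have h := (Matrix.isUnit_iff_isUnit_det H).mp hH.isUnit
  rw [hC, det_mul] at h
  exact isUnit_of_mul_isUnit_right h

theorem spectrum_eq_range_of_injective {m : ℕ} {M : Matrix (Fin m) (Fin m) ℂ} {f : Fin m → ℂ}
    (hf : Function.Injective f) (h : ∀ j, f j ∈ spectrum ℂ M) : spectrum ℂ M = Set.range f := by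
  have hfin : (spectrum ℂ M).Finite := M.finite_spectrum
  symm
  refine Set.eq_of_subset_of_ncard_le (Set.range_subset_iff.mpr h) ?_ hfin
  rw [← Set.image_univ, Set.ncard_image_of_injective _ hf, Set.ncard_univ, Nat.card_fin]
  have hsub : spectrum ℂ M ⊆ (M.charpoly.roots.toFinset : Set ℂ) := by
    intro z hz
    rw [Finset.mem_coe, Multiset.mem_toFinset, Polynomial.mem_roots M.charpoly_monic.ne_zero]
    exact mem_spectrum_iff_isRoot_charpoly.mp hz
  calc (spectrum ℂ M).ncard ≤ (M.charpoly.roots.toFinset : Set ℂ).ncard :=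
        Set.ncard_le_ncard hsub (Finset.finite_toSet _)
    _ = M.charpoly.roots.toFinset.card := Set.ncard_coe_finset _
    _ ≤ M.charpoly.roots.card := Multiset.toFinset_card_le _
    _ ≤ M.charpoly.natDegree := Polynomial.card_roots' _
    _ = m := by rw [charpoly_natDegree_eq_dim, Fintype.card_fin]

/-! ### Continuity of β and K -/

section Continuity

variable {X : Type*} [TopologicalSpace X] {n : ℕ} {α : X → Fin n → ℂ} {τ : X → ℂ} {ζ s : ℂ}

theorem continuous_pseudoReflection (hα : ∀ t j, ‖α t j‖ < 1) (hτ : ∀ t, ‖τ t‖ = 1)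
    (hζ : ‖ζ‖ = 1) (hαc : ∀ j, Continuous fun t => α t j) (hτc : Continuous τ)
    (j : Fin (n + 1)) : Continuous fun t => pseudoReflection (α t) (τ t) ζ j := by
  induction j using Fin.reverseInduction with
  | last => simpa only [pseudoReflection_last] using hτc
  | cast j ih =>
    simp only [pseudoReflection_castSucc]
    have h1 := hαc j
    have h2 := Complex.continuous_conj.comp h1
    refine Continuous.div (by fun_prop) ((h2.mul ih).add continuous_const) fun t => ?_
    exact conj_mul_add_conj_ne_zero (hα t j) (norm_pseudoReflection (hα t) (hτ t) hζ _) hζ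

theorem continuous_pivot (hα : ∀ t j, ‖α t j‖ < 1) (hτ : ∀ t, ‖τ t‖ = 1)
    (hζ : ‖ζ‖ = 1) (hαc : ∀ j, Continuous fun t => α t j) (hτc : Continuous τ)
    (j : Fin (n + 1)) : Continuous fun t => pivot (α t) (τ t) ζ j := by
  induction j using Fin.induction with
  | zero => exact continuous_const
  | succ j ih =>
    simp only [pivot_succ]
    have h1 := hαc j
    have h2 := Complex.continuous_conj.comp h1
    have h3 := continuous_pseudoReflection hα hτ hζ hαc hτc j.castSucc
    refine Continuous.div (by fun_prop)
      (ih.mul ((continuous_const.sub (h2.mul h3)).norm.pow 2)) fun t => ?_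
    have h4 := one_sub_conj_mul_pseudoReflection_ne_zero (hα t) (hτ t) hζ j j.castSucc
    exact mul_ne_zero (pivot_pos (hα t) (hτ t) hζ _).ne' (pow_ne_zero 2 (norm_ne_zero_iff.mpr h4))

theorem continuous_beta (hα : ∀ t j, ‖α t j‖ < 1) (hτ : ∀ t, ‖τ t‖ = 1)
    (hζ : ‖ζ‖ = 1) (hs : s ^ 2 = ζ) (h0 : ∀ t, ζ * pseudoReflection (α t) (τ t) ζ 0 ≠ 1)
    (hαc : ∀ j, Continuous fun t => α t j) (hτc : Continuous τ)
    (j : Fin (n + 1)) : Continuous fun t => beta (α t) (τ t) ζ s j := by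
  have hs1 := norm_sqrt_eq_one hζ hs
  have hs0 : s ≠ 0 := norm_ne_zero_iff.mp (by rw [hs1]; norm_num)
  -- A case split suffices: the closed form of β_{j+1} does not involve β_j.
  induction j using Fin.cases with
  | zero =>
    simp only [beta_zero]
    have h3 := continuous_pseudoReflection hα hτ hζ hαc hτc 0
    exact continuous_const.div (continuous_const.sub (h3.mul continuous_const)) fun t =>
      inv_sub_pseudoReflection_mul_ne_zero hζ hs (h0 t)
  | succ j =>
    have hb := fun t => beta_succ (hα t) (hτ t) hζ hs (h0 t) j
    simp only [hb]
    have h1 := hαc j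
    have h3 := Complex.continuous_conj.comp
      (continuous_pseudoReflection hα hτ hζ hαc hτc j.castSucc)
    have h4 := Complex.continuous_ofReal.comp (continuous_pivot hα hτ hζ hαc hτc j.castSucc)
    refine continuous_const.div (h4.mul (continuous_const.sub (h3.mul h1))) fun t => ?_
    have hD := one_sub_conj_mul_pseudoReflection_ne_zero (hα t) (hτ t) hζ j j.castSucc
    have hD' := (map_ne_zero conj).mpr hD
    refine mul_ne_zero (Complex.ofReal_ne_zero.mpr (pivot_pos (hα t) (hτ t) hζ _).ne') ?_
    simpa [mul_comm] using hD'

theorem continuous_skewPart (hc : ∀ j, Continuous fun t => beta (α t) (τ t) ζ s j)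
    (i k : Fin (n + 1)) : Continuous fun t => skewPart (α t) (τ t) ζ s i k := by
  have hd : ∀ j, Continuous fun t => diagEntry (α t) (τ t) ζ s j := fun j =>
    continuous_const.mul (Complex.continuous_conj.comp (hc j))
  have hA : ∀ i k, Continuous fun t => dissipative (α t) (τ t) ζ s i k := by
    intro i k
    simp only [dissipative_apply]
    refine Continuous.add ?_ continuous_const
    split_ifs
    · exact hd i
    · exact continuous_const
  simp only [skewPart, Matrix.smul_apply, Matrix.sub_apply, conjTranspose_apply, smul_eq_mul]
  exact continuous_const.mul ((hA i k).sub (hA k i).star)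

end Continuity

/-! ### Eigenvalues of the reduced Hermitian matrix -/

section Eigenvalues

variable {n : ℕ} {α : Fin n → ℂ} {τ ζ s : ℂ} {C : Matrix (Fin (n + 1)) (Fin (n + 1)) ℂ}

/-- The Hermitian matrix whose eigenvalues are those of the pencil `K - c H`, `H = C* C`. -/
noncomputable def reduced {n : ℕ} (C : Matrix (Fin (n + 1)) (Fin (n + 1)) ℂ) (α : Fin n → ℂ)
    (τ ζ s : ℂ) : Matrix (Fin (n + 1)) (Fin (n + 1)) ℂ :=
  (C⁻¹)ᴴ * skewPart α τ ζ s * C⁻¹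

theorem isHermitian_reduced (C : Matrix (Fin (n + 1)) (Fin (n + 1)) ℂ) (α : Fin n → ℂ)
    (τ ζ s : ℂ) : (reduced C α τ ζ s).IsHermitian :=
  isHermitian_conjTranspose_mul_mul C⁻¹ isHermitian_skewPart

theorem dotProduct_reduced_mulVec (x : Fin (n + 1) → ℂ) :
    star x ⬝ᵥ reduced C α τ ζ s *ᵥ x =
      star (C⁻¹ *ᵥ x) ⬝ᵥ skewPart α τ ζ s *ᵥ (C⁻¹ *ᵥ x) := by
  rw [reduced, ← mulVec_mulVec, ← mulVec_mulVec, dotProduct_mulVec, star_mulVec]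

theorem skewPart_mulVec_of_reduced (hC : IsUnit C.det) (hH : hermitianPart α τ ζ s = Cᴴ * C)
    {c : ℝ} {v : Fin (n + 1) → ℂ} (h : reduced C α τ ζ s *ᵥ v = (c : ℂ) • v) :
    skewPart α τ ζ s *ᵥ (C⁻¹ *ᵥ v) = (c : ℂ) • hermitianPart α τ ζ s *ᵥ (C⁻¹ *ᵥ v) := by
  have h1 : Cᴴ * reduced C α τ ζ s = skewPart α τ ζ s * C⁻¹ := by
    rw [reduced, ← mul_assoc, ← mul_assoc, ← conjTranspose_mul, nonsing_inv_mul _ hC,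
      conjTranspose_one, one_mul]
  rw [mulVec_mulVec, ← h1, ← mulVec_mulVec, h, hH, mulVec_smul, mulVec_mulVec, mul_assoc,
    mul_nonsing_inv _ hC, mul_one]

theorem inv_mulVec_ne_zero (hC : IsUnit C.det) {v : Fin (n + 1) → ℂ} (hv : v ≠ 0) :
    C⁻¹ *ᵥ v ≠ 0 := by
  intro h
  apply hv
  rw [← one_mulVec v, ← mul_nonsing_inv _ hC, ← mulVec_mulVec, h, mulVec_zero]

theorem reduced_mulVec_eigenvectorBasis (j : Fin (n + 1)) :
    reduced C α τ ζ s *ᵥ (isHermitian_reduced C α τ ζ s).eigenvectorBasis j =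
      (((isHermitian_reduced C α τ ζ s).eigenvalues j : ℝ) : ℂ) •
        ((isHermitian_reduced C α τ ζ s).eigenvectorBasis j : Fin (n + 1) → ℂ) := by
  rw [(isHermitian_reduced C α τ ζ s).mulVec_eigenvectorBasis j]
  rfl

theorem eigenvectorBasis_ne_zero (j : Fin (n + 1)) :
    ((isHermitian_reduced C α τ ζ s).eigenvectorBasis j :
      Fin (n + 1) → ℂ) ≠ 0 := by
  intro h
  refine (isHermitian_reduced C α τ ζ s).eigenvectorBasis.orthonormal.ne_zero j ?_
  ext k
  exact congrFun h k

theorem mul_mem_spectrum_hessenberg (hα : ∀ j, ‖α j‖ < 1) (hτ : ‖τ‖ = 1) (hζ : ‖ζ‖ = 1)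
    (hs : s ^ 2 = ζ) (h0 : ζ * pseudoReflection α τ ζ 0 ≠ 1) (hC : IsUnit C.det)
    (hH : hermitianPart α τ ζ s = Cᴴ * C) (j : Fin (n + 1)) :
    let c := (isHermitian_reduced C α τ ζ s).eigenvalues j
    ζ * (((c : ℂ) + Complex.I) / ((c : ℂ) - Complex.I)) ∈ spectrum ℂ (hessenberg α τ) :=
  mem_spectrum_of_pencil_mulVec_eq_zero hα hτ hζ hs h0
    (inv_mulVec_ne_zero hC (eigenvectorBasis_ne_zero j))
    (pencil_mulVec_eq_zero_of_skewPart
      (skewPart_mulVec_of_reduced hC hH (reduced_mulVec_eigenvectorBasis j)))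

/-- Two orthonormal eigenvectors with the same eigenvalue would combine into a nonzero kernel vector
of the pencil with vanishing coordinate 0. -/
theorem eigenvalues_reduced_injective (hs0 : s ≠ 0) (hC : IsUnit C.det)
    (hH : hermitianPart α τ ζ s = Cᴴ * C) : Function.Injective
      (isHermitian_reduced C α τ ζ s).eigenvalues := by
  intro i j hij
  by_contra hne
  set b := (isHermitian_reduced C α τ ζ s).eigenvectorBasis
    with hb
  have hvi := reduced_mulVec_eigenvectorBasis (C := C) (α := α) (τ := τ) (ζ := ζ) (s := s) i
  have hvj := reduced_mulVec_eigenvectorBasis (C := C) (α := α) (τ := τ) (ζ := ζ) (s := s) j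
  rw [hij] at hvi
  rw [← hb] at hvi hvj
  have key : ∀ p q : ℂ, p * (C⁻¹ *ᵥ (b i).ofLp) 0 + q * (C⁻¹ *ᵥ (b j).ofLp) 0 = 0 →
      p • b i + q • b j = 0 := by
    intro p q hpq
    by_contra hv
    have hv' : p • (b i).ofLp + q • (b j).ofLp ≠ 0 := by
      intro h
      apply hv
      ext k
      simpa using congrFun h k
    refine inv_mulVec_ne_zero hC hv' (eq_zero_of_pencil_mulVec_eq_zero hs0
      (pencil_mulVec_eq_zero_of_skewPart (skewPart_mulVec_of_reduced hC hH
        (c := (isHermitian_reduced C α τ ζ s).eigenvalues j)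
        ?_)) ?_)
    · rw [mulVec_add, mulVec_smul, mulVec_smul, hvi, hvj, smul_add, smul_comm p, smul_comm q]
    · rw [mulVec_add, mulVec_smul, mulVec_smul]
      simpa using hpq
  have coef : ∀ p q : ℂ, p • b i + q • b j = 0 → p = 0 ∧ q = 0 := by
    intro p q h
    have hi := congrArg (inner ℂ (b i)) h
    have hj := congrArg (inner ℂ (b j)) h
    rw [inner_add_right, inner_smul_right, inner_smul_right, inner_zero_right] at hi hj
    simpa [b.orthonormal.inner_eq_zero hne, b.orthonormal.inner_eq_zero (Ne.symm hne)] using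
      And.intro hi hj
  -- These coefficients cancel coordinate 0, so both coordinates vanish; then `b i` alone already
  -- gives the contradiction.
  have h1 := coef _ _ (key ((C⁻¹ *ᵥ (b j).ofLp) 0) (-(C⁻¹ *ᵥ (b i).ofLp) 0) (by ring))
  have h2 := coef _ _ (key 1 0 (by rw [neg_eq_zero.mp h1.2]; ring))
  exact one_ne_zero h2.1

/-- The difference of the two matrices K is a definite diagonal matrix; congruence by the invertible
C⁻¹ keeps it definite, and Weyl's inequality applies with ε = 0. -/
theorem eigenvalues_reduced_lt {α' : Fin n → ℂ} {τ' : ℂ} (hC : IsUnit C.det)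
    (h : ∀ j, (diagEntry α τ ζ s j).im < (diagEntry α' τ' ζ s j).im) (j : Fin (n + 1)) :
    (isHermitian_reduced C α τ ζ s).eigenvalues j <
      (isHermitian_reduced C α' τ' ζ s).eigenvalues j := by
  have := (isHermitian_reduced C α τ ζ s).eigenvalues_lt_eigenvalues_add
    (isHermitian_reduced C α' τ' ζ s) (ε := 0)
    (fun x hx => ?_) j
  · simpa using this
  · rw [zero_mul, add_zero, dotProduct_reduced_mulVec, dotProduct_reduced_mulVec, ← sub_pos,
      re_dotProduct_skewPart_mulVec_sub]
    obtain ⟨k, hk⟩ := Function.ne_iff.mp (inv_mulVec_ne_zero hC hx)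
    have hk' := norm_pos_iff.mpr hk
    refine Finset.sum_pos' (fun i _ => ?_) ⟨k, Finset.mem_univ _, ?_⟩
    · exact mul_nonneg (sub_pos.mpr (h i)).le (by positivity)
    · exact mul_pos (sub_pos.mpr (h k)) (by positivity)

end Eigenvalues

end Popuc

/-! ### The main theorem -/

theorem mainTheorem5 (n : ℕ) (α : ℝ → Fin n → ℂ) (τ : ℝ → ℂ)
    (hα : ∀ t j, ‖α t j‖ < 1) (hτ : ∀ t, ‖τ t‖ = 1)
    (hG : ∀ i k, Differentiable ℝ fun t => Popuc.hessenberg (α t) (τ t) i k)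
    (ζ s : ℂ) (hζ : ‖ζ‖ = 1) (hs : s ^ 2 = ζ)
    (hζS : ∀ t, ζ ∉ spectrum ℂ (Popuc.hessenberg (α t) (τ t)))
    (hH : ∀ t t', Popuc.hermitianPart (α t) (τ t) ζ s = Popuc.hermitianPart (α t') (τ t') ζ s) :
    ∃ θ : Fin (n + 1) → ℝ → ℝ,
      (∀ j, Continuous (θ j)) ∧
      (∀ t, Function.Injective fun j => Complex.exp (θ j t * Complex.I)) ∧
      (∀ t, spectrum ℂ (Popuc.hessenberg (α t) (τ t)) =
        Set.range fun j => Complex.exp (θ j t * Complex.I)) ∧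
      (∀ J : Set ℝ, J.OrdConnected → J.Nontrivial →
        J ⊆ {t | ∀ j, 0 < Popuc.imDeriv α τ ζ s j t} → ∀ j, StrictMonoOn (θ j) J) ∧
      (∀ J : Set ℝ, J.OrdConnected → J.Nontrivial →
        J ⊆ {t | ∀ j, Popuc.imDeriv α τ ζ s j t < 0} → ∀ j, StrictAntiOn (θ j) J) := by
  have hs1 := Popuc.norm_sqrt_eq_one hζ hs
  have hs0 : s ≠ 0 := norm_ne_zero_iff.mp (by rw [hs1]; norm_num)
  have h0 : ∀ t, ζ * Popuc.pseudoReflection (α t) (τ t) ζ 0 ≠ 1 := fun t h =>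
    hζS t (Popuc.mem_spectrum_of_mul_pseudoReflection_zero (hα t) (hτ t) hζ h)
  -- One factor C, taken at t = 0, serves all t because H is constant; this makes the reduced
  -- matrices at different times comparable.
  obtain ⟨C, hC, hHC⟩ := Popuc.exists_eq_conjTranspose_mul_self
    (Popuc.posDef_hermitianPart (hα 0) (hτ 0) hζ hs (h0 0))
  have hHC' : ∀ t, Popuc.hermitianPart (α t) (τ t) ζ s = C.conjTranspose * C := fun t =>
    (hH t 0).trans hHC
  have hβc := Popuc.continuous_beta hα hτ hζ hs h0
    (Popuc.continuous_parameter hα fun k => (hG 0 k).continuous)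
    (Popuc.continuous_last_parameter hα fun k => (hG 0 k).continuous)
  have hherm := fun t => Popuc.isHermitian_reduced C (α t) (τ t) ζ s
  have hBc : ∀ i k, Continuous fun t => Popuc.reduced C (α t) (τ t) ζ s i k := by
    have hK : Continuous fun t => Popuc.skewPart (α t) (τ t) ζ s :=
      continuous_matrix (Popuc.continuous_skewPart hβc)
    have hB : Continuous fun t => Popuc.reduced C (α t) (τ t) ζ s :=
      (continuous_const.matrix_mul hK).matrix_mul continuous_const
    exact fun i k => hB.matrix_elem i k
  have hθ : ∀ t j, Complex.exp (((Complex.arg ζ +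
      (Real.pi - 2 * Real.arctan ((hherm t).eigenvalues j)) : ℝ) : ℂ) * Complex.I) =
      ζ * ((((hherm t).eigenvalues j : ℝ) + Complex.I) /
        (((hherm t).eigenvalues j : ℝ) - Complex.I)) := by
    intro t j
    have hζ' := Complex.norm_mul_exp_arg_mul_I ζ
    rw [hζ, Complex.ofReal_one, one_mul] at hζ'
    rw [Complex.ofReal_add, add_mul, Complex.exp_add, hζ', Popuc.exp_pi_sub_two_mul_arctan]
  have hinj : ∀ t, Function.Injective fun j => ζ * ((((hherm t).eigenvalues j : ℝ) + Complex.I) /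
        (((hherm t).eigenvalues j : ℝ) - Complex.I)) := by
    intro t
    have hζ0 : ζ ≠ 0 := norm_ne_zero_iff.mp (by rw [hζ]; norm_num)
    exact (mul_right_injective₀ hζ0).comp (Popuc.ofReal_add_I_div_sub_I_injective.comp
      (Popuc.eigenvalues_reduced_injective hs0 hC (hHC' t)))
  refine ⟨fun j t => Complex.arg ζ + (Real.pi - 2 * Real.arctan ((hherm t).eigenvalues j)),
    fun j => ?_, fun t => ?_, fun t => ?_, fun J hJ _ hJy j => ?_, fun J hJ _ hJy j => ?_⟩
  · have := Matrix.continuous_eigenvalues hherm hBc j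
    have := Real.continuous_arctan.comp this
    fun_prop
  · simp only [hθ]
    exact hinj t
  · simp only [hθ]
    exact Popuc.spectrum_eq_range_of_injective (hinj t) fun j =>
      Popuc.mul_mem_spectrum_hessenberg (hα t) (hτ t) hζ hs (h0 t) hC (hHC' t) j
  all_goals
    -- Continuity and the sign of `deriv` suffice for strict monotonicity: a nonzero `deriv` already
    -- entails differentiability at the point.
    have hcont : ∀ k, Continuous fun u => (s⁻¹ * Popuc.beta (α u) (τ u) ζ s k).im := fun k =>
      Complex.continuous_im.comp (continuous_const.mul (hβc k))
    intro t ht t' ht' htt'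
  · have hlt : ∀ k, (Popuc.diagEntry (α t') (τ t') ζ s k).im <
        (Popuc.diagEntry (α t) (τ t) ζ s k).im := fun k => by
      have := strictMonoOn_of_deriv_pos hJ.convex (hcont k).continuousOn
        (fun u hu => hJy (interior_subset hu) k) ht ht' htt'
      simpa only [Popuc.im_inv_mul_beta hs1, neg_lt_neg_iff] using this
    have := Real.arctan_strictMono (Popuc.eigenvalues_reduced_lt hC hlt j)
    simp only
    linarith
  · have hlt : ∀ k, (Popuc.diagEntry (α t) (τ t) ζ s k).im <
        (Popuc.diagEntry (α t') (τ t') ζ s k).im := fun k => by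
      have := strictAntiOn_of_deriv_neg hJ.convex (hcont k).continuousOn
        (fun u hu => hJy (interior_subset hu) k) ht ht' htt'
      simpa only [Popuc.im_inv_mul_beta hs1, neg_lt_neg_iff] using this
    have := Real.arctan_strictMono (Popuc.eigenvalues_reduced_lt hC hlt j)
    simp only
    linarith
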